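/- Let $SG_{2,4}(n)$ be the generalized two-dimensional Sierpinski gasket with $b=4$ layers: $SG_{2,4}(0)$ is a triangle, and $SG_{2,4}(n+1)$ is the juxtaposition of ten translated copies of $SG_{2,4}(n)$, arranged as the upward-pointing triangles of a large triangle with $4$ layers, where copies that touch share the corresponding outmost vertex. Let $v(n)$ be its number of vertices. Let $f_n$ be the number of connected spanning subgraphs of $SG_{2,4}(n)$; let $g_n$ be the number of its spanning subgraphs with exactly two connected components such that the topmost outmost vertex belongs to one component and the other two outmost vertices belong to the other one; and let $h_n$ be the number of its spanning subgraphs with exactly three connected components such that the three outmost vertices belong to three different components. Put $\alpha_m=f_m/g_m$, $\beta_m=g_m/h_m$, and $$\begin{aligned}P(m)={}&11354+5856\tfrac{\alpha_m}{\beta_m}+516\tfrac{\alpha_m^2}{\beta_m^2}+2\tfrac{\alpha_m^3}{\beta_m^3}+13626\alpha_m+4140\tfrac{\alpha_m^2}{\beta_m}+174\tfrac{\alpha_m^3}{\beta_m^2}+6936\alpha_m^2\\&+1140\tfrac{\alpha_m^3}{\beta_m}+15\tfrac{\alpha_m^4}{\beta_m^2}+1928\alpha_m^3+144\tfrac{\alpha_m^4}{\beta_m}+309\alpha_m^4+7\tfrac{\alpha_m^5}{\beta_m}+27\alpha_m^5+\alpha_m^6,\end{aligned}$$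 $$\begin{aligned}Q(m)={}&13732+14480\tfrac{\alpha_m}{\beta_m}+2786\tfrac{\alpha_m^2}{\beta_m^2}+82\tfrac{\alpha_m^3}{\beta_m^3}+16250\alpha_m+10609\tfrac{\alpha_m^2}{\beta_m}+1095\tfrac{\alpha_m^3}{\beta_m^2}+12\tfrac{\alpha_m^4}{\beta_m^3}+8015\alpha_m^2\\&+3130\tfrac{\alpha_m^3}{\beta_m}+142\tfrac{\alpha_m^4}{\beta_m^2}+2148\alpha_m^3+462\tfrac{\alpha_m^4}{\beta_m}+6\tfrac{\alpha_m^5}{\beta_m^2}+332\alpha_m^4+34\tfrac{\alpha_m^5}{\beta_m}+28\alpha_m^5+\tfrac{\alpha_m^6}{\beta_m}+\alpha_m^6.\end{aligned}$$ Then for every integer $n\ge 0$, writing $f=f_n$, $g=g_n$, $h=h_n$ on the right-hand sides, $$\begin{aligned}f_{n+1}={}&f^{10}+27f^9g+7f^9h+309f^8g^2+144f^8gh+1928f^7g^3+15f^8h^2+1140f^7g^2h+6936f^6g^4\\&+174f^7gh^2+4140f^6g^3h+13626f^5g^5+2f^7h^3+516f^6g^2h^2+5856f^5g^4h+11354f^4g^6,\end{aligned}$$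 $$\begin{aligned}g_{n+1}={}&f^9g+f^9h+28f^8g^2+34f^8gh+332f^7g^3+6f^8h^2+462f^7g^2h+2148f^6g^4+142f^7gh^2+3130f^6g^3h\\&+8015f^5g^5+12f^7h^3+1095f^6g^2h^2+10609f^5g^4h+16250f^4g^6+82f^6gh^3+2786f^5g^3h^2\\&+14480f^4g^5h+13732f^3g^7,\end{aligned}$$ $$\begin{aligned}h_{n+1}={}&3f^8g^2+6f^8gh+87f^7g^3+3f^8h^2+189f^7g^2h+1068f^6g^4+117f^7gh^2+2558f^6g^3h+7113f^5g^5\\&+15f^7h^3+1869f^6g^2h^2+17763f^5g^4h+26934f^4g^6+444f^6gh^3+12756f^5g^3h^2+61422f^4g^5h\\&+53826f^3g^7+20f^6h^4+2388f^5g^2h^3+30948f^4g^4h^2+83234f^3g^6h+42210f^2g^8.\end{aligned}$$ Moreover, the limit $z_{SG_{2,4}}=\lim_{n\to\infty}\frac{\ln f_n}{v(n)}$ exists, and for every positive integer $m$, $$\frac{\ln f_m+2\ln g_m}{4\cdot 10^m}+\frac{\ln 33620+2\ln 84460}{36\cdot 10^m}\;\le\; z_{SG_{2,4}}\;\le\;\frac{\ln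 f_m+2\ln g_m}{4\cdot 10^m}+\frac{\ln P(m)+2\ln Q(m)}{36\cdot 10^m}.$$ -/

import Mathlib

open Filter Topology

namespace SierpinskiGasket

/-- The cells `(i, j)`, `i + j < b`, of a triangle of side `b` (the upward pointing unit triangles
arranged in `b` layers). A pair `(x, y)` stands for the point `x • (1, 0) + y • (1/2, √3/2)` of the
plane. -/
def cells (b : ℕ) : Finset (ℕ × ℕ) :=
  (Finset.range b ×ˢ Finset.range b).filter fun c => c.1 + c.2 < b

/-- Translation that places a copy of the stage-`n` gasket (whose side length is `b ^ n`) in the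
cell `c` of the stage-`(n + 1)` gasket. -/
def place (b n : ℕ) (c : ℕ × ℕ) : (ℕ × ℕ) ↪ (ℕ × ℕ) :=
  addLeftEmbedding (b ^ n * c.1, b ^ n * c.2)

/-- Vertices of the generalized two-dimensional Sierpinski gasket with `b` layers at stage `n`. -/
def verts (b : ℕ) : ℕ → Finset (ℕ × ℕ)
  | 0 => {(0, 0), (1, 0), (0, 1)}
  | n + 1 => (cells b).biUnion fun c => (verts b n).map (place b n c)

/-- The edges of the gasket, as a graph on the whole lattice: a single triangle at stage `0`, and
at stage `n + 1` the union of the translates of stage `n`, one in each cell. -/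
def latticeGraph (b : ℕ) : ℕ → SimpleGraph (ℕ × ℕ)
  | 0 => SimpleGraph.fromRel fun u v => u ∈ verts b 0 ∧ v ∈ verts b 0
  | n + 1 => ⨆ c ∈ cells b, (latticeGraph b n).map (place b n c)

/-- The generalized Sierpinski gasket `SG_{2,b}(n)`, as a graph on its own vertices. -/
def SG (b n : ℕ) : SimpleGraph (verts b n) :=
  (latticeGraph b n).comap fun v : verts b n => (v : ℕ × ℕ)

theorem corners_mem (b : ℕ) [NeZero b] (n : ℕ) :
    (0, 0) ∈ verts b n ∧ (b ^ n, 0) ∈ verts b n ∧ (0, b ^ n) ∈ verts b n := by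
  have hb : 0 < b := Nat.pos_of_ne_zero (NeZero.ne b)
  induction n with
  | zero => simp [verts]
  | succ n ih =>
    have e : b ^ n * (b - 1) + b ^ n = b ^ (n + 1) := by
      rw [pow_succ, ← Nat.mul_succ, Nat.succ_eq_add_one, Nat.sub_add_cancel hb]
    obtain ⟨h1, h2, h3⟩ := ih
    simp only [verts, Finset.mem_biUnion, Finset.mem_map]
    exact ⟨⟨(0, 0), by simp [cells, hb], (0, 0), h1, by simp [place]⟩,
      ⟨(b - 1, 0), by simp [cells, hb], (b ^ n, 0), h2, by simp [place, e]⟩,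
      ⟨(0, b - 1), by simp [cells, hb], (0, b ^ n), h3, by simp [place, e]⟩⟩

/-- The lower left outmost vertex. -/
def left (b n : ℕ) [NeZero b] : verts b n := ⟨(0, 0), (corners_mem b n).1⟩

/-- The lower right outmost vertex. -/
def right (b n : ℕ) [NeZero b] : verts b n := ⟨(b ^ n, 0), (corners_mem b n).2.1⟩

/-- The topmost vertex. -/
def top (b n : ℕ) [NeZero b] : verts b n := ⟨(0, b ^ n), (corners_mem b n).2.2⟩

/-- The number of connected spanning subgraphs of `G`. A spanning subgraph has the same vertex set
as `G`, hence is a graph `H ≤ G` on that vertex set. -/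
noncomputable def numCSSG {V : Type*} (G : SimpleGraph V) : ℕ :=
  {H : SimpleGraph V | H ≤ G ∧ H.Connected}.ncard

/-- `f_{2,b}(n)`: the number of connected spanning subgraphs of `SG_{2,b}(n)`. -/
noncomputable def f (b n : ℕ) : ℕ := numCSSG (SG b n)

/-- `g_{2,b}(n)`: the number of spanning subgraphs with exactly two connected components, one
containing the topmost vertex and the other one the other two outmost vertices. -/
noncomputable def g (b n : ℕ) [NeZero b] : ℕ :=
  {H : SimpleGraph (verts b n) | H ≤ SG b n ∧ Nat.card H.ConnectedComponent = 2 ∧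
    H.Reachable (left b n) (right b n) ∧ ¬ H.Reachable (top b n) (left b n)}.ncard

/-- `h_{2,b}(n)`: the number of spanning subgraphs with exactly three connected components, the
three outmost vertices lying in three different ones. -/
noncomputable def h (b n : ℕ) [NeZero b] : ℕ :=
  {H : SimpleGraph (verts b n) | H ≤ SG b n ∧ Nat.card H.ConnectedComponent = 3 ∧
    ¬ H.Reachable (left b n) (right b n) ∧ ¬ H.Reachable (top b n) (left b n) ∧
    ¬ H.Reachable (top b n) (right b n)}.ncard

/-- `α_{2,b}(n) = f_{2,b}(n) / g_{2,b}(n)`. -/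
noncomputable def α (b n : ℕ) [NeZero b] : ℝ := (f b n : ℝ) / (g b n : ℝ)

/-- `β_{2,b}(n) = g_{2,b}(n) / h_{2,b}(n)`. -/
noncomputable def β (b n : ℕ) [NeZero b] : ℝ := (g b n : ℝ) / (h b n : ℝ)

/-- `P_{2,4}(m)`. -/
noncomputable def P24 (m : ℕ) : ℝ :=
  11354 + 5856 * (α 4 m / β 4 m) + 516 * (α 4 m ^ 2 / β 4 m ^ 2) + 2 * (α 4 m ^ 3 / β 4 m ^ 3)
    + 13626 * α 4 m + 4140 * (α 4 m ^ 2 / β 4 m)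
    + 174 * (α 4 m ^ 3 / β 4 m ^ 2) + 6936 * α 4 m ^ 2 + 1140 * (α 4 m ^ 3 / β 4 m)
    + 15 * (α 4 m ^ 4 / β 4 m ^ 2) + 1928 * α 4 m ^ 3
    + 144 * (α 4 m ^ 4 / β 4 m) + 309 * α 4 m ^ 4 + 7 * (α 4 m ^ 5 / β 4 m) + 27 * α 4 m ^ 5
    + α 4 m ^ 6

/-- `Q_{2,4}(m)`. -/
noncomputable def Q24 (m : ℕ) : ℝ :=
  13732 + 14480 * (α 4 m / β 4 m) + 2786 * (α 4 m ^ 2 / β 4 m ^ 2) + 82 * (α 4 m ^ 3 / β 4 m ^ 3)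
    + 16250 * α 4 m
    + 10609 * (α 4 m ^ 2 / β 4 m) + 1095 * (α 4 m ^ 3 / β 4 m ^ 2) + 12 * (α 4 m ^ 4 / β 4 m ^ 3)
    + 8015 * α 4 m ^ 2 + 3130 * (α 4 m ^ 3 / β 4 m)
    + 142 * (α 4 m ^ 4 / β 4 m ^ 2) + 2148 * α 4 m ^ 3 + 462 * (α 4 m ^ 4 / β 4 m)
    + 6 * (α 4 m ^ 5 / β 4 m ^ 2) + 332 * α 4 m ^ 4
    + 34 * (α 4 m ^ 5 / β 4 m) + 28 * α 4 m ^ 5 + α 4 m ^ 6 / β 4 m + α 4 m ^ 6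

end SierpinskiGasket

namespace SierpinskiGasket

/-- The ways in which a spanning subgraph of a copy, each component of which meets the set of the
three outmost vertices, can connect these vertices: all of them are connected, or all but one,
or none. -/
inductive CellState
  | all
  | solo (i : Fin 3)
  | apart
  deriving DecidableEq

namespace CellState

/-- Connectedness of two outmost vertices. -/
def rel : CellState → Fin 3 → Fin 3 → Bool
  | all, _, _ => true
  | solo k, i, j => i == j || (i != k && j != k)
  | apart, i, j => i == j

/-- Pairs of outmost vertices that generate `rel`. -/
def links : CellState → List (Fin 3 × Fin 3)
  | all => [(0, 1), (1, 2)]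
  | solo k => [(k + 1, k + 2)]
  | apart => []

instance : Fintype CellState where
  elems := {all, solo 0, solo 1, solo 2, apart}
  complete s := by
    rcases s with _ | i | _
    · simp
    · fin_cases i <;> simp
    · simp

theorem sum_eq {R : Type*} [AddCommMonoid R] (F : CellState → R) :
    ∑ s, F s = F all + (F (solo 0) + (F (solo 1) + (F (solo 2) + F apart))) := by
  change ∑ s ∈ ({all, solo 0, solo 1, solo 2, apart} : Finset CellState), F s = _
  rw [Finset.sum_insert (by decide), Finset.sum_insert (by decide), Finset.sum_insert (by decide),
    Finset.sum_insert (by decide), Finset.sum_singleton]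

/-- The weight of a state, depending on its type only. -/
def weight {R : Type*} (f g h : R) : CellState → R
  | all => f
  | solo _ => g
  | apart => h

end CellState

open CellState

/-! ### Merging labels -/

/-- Identify the classes of `a` and `b`; the larger label survives. -/
def merge (F : ℕ → ℕ) (a b : ℕ) : ℕ → ℕ := fun x =>
  if F x = min (F a) (F b) then max (F a) (F b) else F x

/-- Merge along a list of pairs. -/
def mergeAll (M : List (ℕ × ℕ)) (F : ℕ → ℕ) : ℕ → ℕ :=
  M.foldl (fun F p => merge F p.1 p.2) F

/-- The pairs of vertices to be merged for a cell with vertices `v` in state `s`. -/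
def cellLinks (v : Fin 3 → ℕ) (s : CellState) : List (ℕ × ℕ) :=
  s.links.map fun p => (v p.1, v p.2)

theorem le_merge {F : ℕ → ℕ} {a b : ℕ} (x : ℕ) : F x ≤ merge F a b x := by
  unfold merge; split_ifs <;> omega

theorem merge_congr {F : ℕ → ℕ} {a b x y : ℕ} (h : F x = F y) :
    merge F a b x = merge F a b y := by
  simp [merge, h]

theorem merge_self {F : ℕ → ℕ} {a b : ℕ} : merge F a b a = merge F a b b := by
  unfold merge; split_ifs <;> omega

theorem merge_lt {F : ℕ → ℕ} {a b x N : ℕ} (ha : F a < N) (hb : F b < N) (hx : F x < N) :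
    merge F a b x < N := by
  unfold merge; split_ifs <;> omega

theorem merge_idem {F : ℕ → ℕ} (hF : ∀ x, F (F x) = F x) (a b x : ℕ) :
    merge F a b (merge F a b x) = merge F a b x := by
  have h1 : F (min (F a) (F b)) = min (F a) (F b) := by
    rcases min_choice (F a) (F b) with h | h <;> rw [h, hF]
  have h2 : F (max (F a) (F b)) = max (F a) (F b) := by
    rcases max_choice (F a) (F b) with h | h <;> rw [h, hF]
  unfold merge
  split_ifs <;> simp_all

theorem merge_sound {F : ℕ → ℕ} (r : Setoid ℕ) (hF : ∀ x y, F x = F y → r x y) {a b : ℕ}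
    (hab : r a b) (x y : ℕ) (h : merge F a b x = merge F a b y) : r x y := by
  have key : ∀ z, merge F a b z = max (F a) (F b) → r z a := by
    intro z hz
    have : F z = F a ∨ F z = F b := by
      unfold merge at hz; split_ifs at hz <;> omega
    rcases this with h | h
    · exact hF _ _ h
    · exact r.trans (hF _ _ h) (r.symm hab)
  by_cases hx : merge F a b x = max (F a) (F b)
  · exact r.trans (key x hx) (r.symm (key y (h ▸ hx)))
  · have hy : merge F a b y ≠ max (F a) (F b) := h ▸ hx
    apply hF
    unfold merge at h hx hy
    split_ifs at h hx hy <;> simp_all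

@[simp] theorem mergeAll_nil (F : ℕ → ℕ) : mergeAll [] F = F := rfl

@[simp] theorem mergeAll_cons (p : ℕ × ℕ) (M : List (ℕ × ℕ)) (F : ℕ → ℕ) :
    mergeAll (p :: M) F = mergeAll M (merge F p.1 p.2) := rfl

theorem mergeAll_append (M M' : List (ℕ × ℕ)) (F : ℕ → ℕ) :
    mergeAll (M ++ M') F = mergeAll M' (mergeAll M F) := List.foldl_append

theorem le_mergeAll (M : List (ℕ × ℕ)) (F : ℕ → ℕ) (x : ℕ) : F x ≤ mergeAll M F x := by
  induction M generalizing F with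
  | nil => exact le_rfl
  | cons p M ih => exact (le_merge x).trans (ih _)

theorem mergeAll_congr (M : List (ℕ × ℕ)) {F : ℕ → ℕ} {x y : ℕ} (h : F x = F y) :
    mergeAll M F x = mergeAll M F y := by
  induction M generalizing F with
  | nil => exact h
  | cons p M ih => exact ih (merge_congr h)

theorem mergeAll_complete {M : List (ℕ × ℕ)} {F : ℕ → ℕ} {p : ℕ × ℕ} (hp : p ∈ M) :
    mergeAll M F p.1 = mergeAll M F p.2 := by
  induction M generalizing F with
  | nil => simp at hp
  | cons q M ih =>
    rcases List.mem_cons.1 hp with rfl | h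
    · exact mergeAll_congr M merge_self
    · exact ih h

theorem mergeAll_sound {M : List (ℕ × ℕ)} {F : ℕ → ℕ} (r : Setoid ℕ)
    (hF : ∀ x y, F x = F y → r x y) (hM : ∀ p ∈ M, r p.1 p.2) (x y : ℕ)
    (h : mergeAll M F x = mergeAll M F y) : r x y := by
  induction M generalizing F with
  | nil => exact hF _ _ h
  | cons q M ih =>
    exact ih (merge_sound r hF (hM q List.mem_cons_self))
      (fun p hp => hM p (List.mem_cons_of_mem _ hp)) h

theorem mergeAll_idem (M : List (ℕ × ℕ)) {F : ℕ → ℕ} (hF : ∀ x, F (F x) = F x) (x : ℕ) :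
    mergeAll M F (mergeAll M F x) = mergeAll M F x := by
  induction M generalizing F with
  | nil => exact hF x
  | cons q M ih => exact ih (merge_idem hF _ _)

theorem mergeAll_lt {M : List (ℕ × ℕ)} {F : ℕ → ℕ} {N : ℕ} (hF : ∀ x < N, F x < N)
    (hM : ∀ p ∈ M, p.1 < N ∧ p.2 < N) {x : ℕ} (hx : x < N) : mergeAll M F x < N := by
  induction M generalizing F with
  | nil => exact hF x hx
  | cons q M ih =>
    obtain ⟨h1, h2⟩ := hM q List.mem_cons_self
    exact ih (fun y hy => merge_lt (hF _ h1) (hF _ h2) (hF _ hy))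
      (fun p hp => hM p (List.mem_cons_of_mem _ hp))

theorem mergeAll_fixed {M : List (ℕ × ℕ)} {F : ℕ → ℕ} {x : ℕ} (hF : ∀ y, y ≤ F y)
    (hM : ∀ p ∈ M, x < p.1 ∧ x < p.2) (hx : F x = x) : mergeAll M F x = x := by
  induction M generalizing F with
  | nil => exact hx
  | cons q M ih =>
    obtain ⟨h1, h2⟩ := hM q List.mem_cons_self
    refine ih (fun y => (hF y).trans (le_merge y)) (fun p hp => hM p (List.mem_cons_of_mem _ hp)) ?_
    have := hF q.1
    have := hF q.2
    change merge F q.1 q.2 x = x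
    unfold merge
    rw [if_neg (by omega), hx]

theorem mem_cellLinks {v : Fin 3 → ℕ} {s : CellState} {p : ℕ × ℕ} (hp : p ∈ cellLinks v s) :
    ∃ i j, s.rel i j ∧ p = (v i, v j) := by
  obtain ⟨⟨i, j⟩, hq, rfl⟩ := List.mem_map.1 hp
  refine ⟨i, j, ?_, rfl⟩
  clear hp
  revert s i j
  decide

theorem eq_of_rel_of_cellLinks {v : Fin 3 → ℕ} {s : CellState} {F : ℕ → ℕ}
    (h : ∀ p ∈ cellLinks v s, F p.1 = F p.2) {i j : Fin 3} (hij : s.rel i j) :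
    F (v i) = F (v j) := by
  rcases s with _ | k | _
  · have h1 := h (v 0, v 1) (by simp [cellLinks, links])
    have h2 := h (v 1, v 2) (by simp [cellLinks, links])
    fin_cases i <;> fin_cases j <;> simp_all
  · have h1 := h (v (k + 1), v (k + 2)) (by simp [cellLinks, links])
    revert hij h1
    clear h
    fin_cases k <;> fin_cases i <;> fin_cases j <;> simp +contextual [rel]
  · simp only [rel, beq_iff_eq] at hij
    rw [hij]

/-! ### Polynomials in three variables as nested lists of coefficients -/

/-- Horner evaluation of a list of coefficients. -/
def evalList {α R : Type*} [Semiring R] (x : R) (ev : α → R) : List α → R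
  | [] => 0
  | c :: cs => ev c + x * evalList x ev cs

/-- Sum of two lists of coefficients. -/
def addList {α : Type*} (add : α → α → α) : List α → List α → List α
  | [], l => l
  | l, [] => l
  | a :: l, b :: l' => add a b :: addList add l l'

theorem evalList_addList {α R : Type*} [CommSemiring R] (x : R) (ev : α → R) (add : α → α → α)
    (h : ∀ a b, ev (add a b) = ev a + ev b) (l l' : List α) :
    evalList x ev (addList add l l') = evalList x ev l + evalList x ev l' := by
  induction l generalizing l' with
  | nil => simp [addList, evalList]
  | cons a l ih =>
    cases l' with
    | nil => simp [addList, evalList]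
    | cons b l' => simp only [addList, evalList, ih, h]; ring

theorem evalList_map {α R : Type*} [CommSemiring R] (x y : R) (ev : α → R) (m : α → α)
    (h : ∀ a, ev (m a) = y * ev a) (l : List α) :
    evalList x ev (l.map m) = y * evalList x ev l := by
  induction l with
  | nil => simp [evalList]
  | cons a l ih => simp only [List.map_cons, evalList, ih, h]; ring

/-- Polynomials in `f`, `g`, `h`: the outer list is indexed by the exponent of `f`, the innermost
lists by the exponent of `h`. -/
abbrev Poly := List (List (List ℕ))

namespace Poly

/-- Sum of polynomials. -/
def add : Poly → Poly → Poly := addList (addList (addList Nat.add))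

/-- Multiplication by the weight of a state. -/
def mulState : CellState → Poly → Poly
  | all, p => [] :: p
  | solo _, p => p.map fun q => [] :: q
  | apart, p => p.map fun q => q.map fun r => 0 :: r

/-- Evaluation of a polynomial. -/
def eval {R : Type*} [Semiring R] (f g h : R) : Poly → R :=
  evalList f (evalList g (evalList h Nat.cast))

variable {R : Type*} [CommSemiring R] (f g h : R)

theorem eval_add (p q : Poly) : eval f g h (add p q) = eval f g h p + eval f g h q :=
  evalList_addList _ _ _ (evalList_addList _ _ _ (evalList_addList _ _ _ fun a b =>
    Nat.cast_add a b)) p q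

theorem eval_mulState (s : CellState) (p : Poly) :
    eval f g h (mulState s p) = s.weight f g h * eval f g h p := by
  cases s
  · simp [mulState, eval, evalList, weight]
  · exact evalList_map _ _ _ _ (fun a => by simp [evalList, weight]) p
  · exact evalList_map _ _ _ _ (fun a => evalList_map _ _ _ _ (fun b => by simp [evalList, weight]) a) p

end Poly

/-! ### Summation over all families of states -/

/-- A cell is given by its three vertices, together with the number of vertices that do not occur
in later cells and can be forgotten, in increasing order. -/
abbrev Cell := (Fin 3 → ℕ) × ℕ

/-- The labels of the outmost vertices `12`, `13`, `14` in a given state. -/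
def outerLabels : CellState → List ℕ
  | all => [14, 14, 14]
  | solo i => [![12, 14, 13] i, ![14, 13, 13] i, 14]
  | apart => [12, 13, 14]

/-- All inner vertices are joined to outmost vertices, which are joined to each other as in
state `t`. -/
def Final (t : CellState) (F : ℕ → ℕ) : Prop :=
  (∀ x < 12, F x ≠ x) ∧ [F 12, F 13, F 14] = outerLabels t

/-- All links of a list of cells in given states. -/
def allLinks : (ps : List Cell) → (Fin ps.length → CellState) → List (ℕ × ℕ)
  | [], _ => []
  | p :: ps, s => cellLinks p.1 (s 0) ++ allLinks ps fun i => s i.succ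

theorem mem_allLinks {ps : List Cell} {s : Fin ps.length → CellState} {q : ℕ × ℕ} :
    q ∈ allLinks ps s ↔ ∃ i, q ∈ cellLinks (ps.get i).1 (s i) := by
  induction ps with
  | nil => simp [allLinks]
  | cons p ps ih =>
    rw [allLinks, List.mem_append, ih]
    constructor
    · rintro (h | ⟨i, h⟩)
      · exact ⟨0, h⟩
      · exact ⟨i.succ, h⟩
    · rintro ⟨i, h⟩
      induction i using Fin.cases with
      | zero => exact Or.inl h
      | succ i => exact Or.inr ⟨i, h⟩

section Sum

variable {R : Type*} [CommSemiring R] (w : CellState → R) (t : CellState)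

open Classical in
/-- The weighted number of families of states of the given cells that lead to a final state. -/
noncomputable def treeSum : List Cell → (ℕ → ℕ) → R
  | [], F => if Final t F then 1 else 0
  | p :: ps, F => ∑ s, w s * treeSum ps (mergeAll (cellLinks p.1 s) F)

open Classical in
theorem treeSum_eq_sum (ps : List Cell) (F : ℕ → ℕ) :
    treeSum w t ps F = ∑ s : Fin ps.length → CellState,
      (∏ i, w (s i)) * if Final t (mergeAll (allLinks ps s) F) then 1 else 0 := by
  induction ps generalizing F with
  | nil => simp only [treeSum, allLinks, mergeAll_nil]; simp; congr
  | cons p ps ih =>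
    refine Eq.trans ?_ ((Fin.consEquiv fun _ : Fin (ps.length + 1) => CellState).sum_comp _)
    rw [treeSum, Fintype.sum_prod_type]
    refine Finset.sum_congr rfl fun a _ => ?_
    rw [ih, Finset.mul_sum]
    refine Finset.sum_congr rfl fun s _ => ?_
    simp only [allLinks, mergeAll_append, List.length_cons, Fin.prod_univ_succ, Fin.consEquiv,
      Equiv.coe_fn_mk, Fin.cons_zero, Fin.cons_succ, mul_assoc]

/-- The cells only involve vertices that are not forgotten yet. -/
def Valid : ℕ → List Cell → Prop
  | d, [] => d = 12
  | d, p :: ps => (∀ i, d ≤ p.1 i ∧ p.1 i < 15) ∧ d + p.2 ≤ 12 ∧ Valid (d + p.2) ps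

theorem cellLinks_bound {v : Fin 3 → ℕ} {P : ℕ → Prop} (hv : ∀ i, P (v i)) {s : CellState} :
    ∀ p ∈ cellLinks v s, P p.1 ∧ P p.2 := by
  intro p hp
  obtain ⟨i, j, -, rfl⟩ := mem_cellLinks hp
  exact ⟨hv i, hv j⟩

theorem treeSum_eq_zero {ps : List Cell} {d : ℕ} (hv : Valid d ps) {F : ℕ → ℕ}
    (hF : ∀ y, y ≤ F y) {x : ℕ} (hx : x < d) (hd : d ≤ 12) (hFx : F x = x) :
    treeSum w t ps F = 0 := by
  induction ps generalizing F d with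
  | nil => exact if_neg fun h => h.1 x (hx.trans_le hd) hFx
  | cons p ps ih =>
    refine Finset.sum_eq_zero fun s _ => ?_
    obtain ⟨h1, h2, h3⟩ := hv
    rw [ih h3 (fun y => (hF y).trans (le_mergeAll _ _ y)) (by omega) h2, mul_zero]
    exact mergeAll_fixed hF (cellLinks_bound fun i => hx.trans_le (h1 i).1) hFx

/-! ### The same sum, with forgotten vertices -/

/-- The labels of the vertices that are not forgotten. -/
def window (F : ℕ → ℕ) (d : ℕ) : List ℕ := (List.range' d (15 - d)).map F

/-- `mergeAll` on a list of labels. -/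
def joinList (d : ℕ) (M : List (ℕ × ℕ)) (l : List ℕ) : List ℕ :=
  M.foldl (fun l p => l.map fun x =>
    if x = min (l.getD (p.1 - d) 0) (l.getD (p.2 - d) 0) then
      max (l.getD (p.1 - d) 0) (l.getD (p.2 - d) 0) else x) l

/-- Forget the first `k` vertices, if each of them is joined to a later one. -/
def forget : ℕ → ℕ → List ℕ → Option (List ℕ)
  | 0, _, l => some l
  | _ + 1, _, [] => none
  | k + 1, d, x :: l => if x = d then none else forget k (d + 1) l

/-- `treeSum` on lists of labels. -/
def listSum : List Cell → ℕ → List ℕ → R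
  | [], _, l => if l = outerLabels t then 1 else 0
  | p :: ps, d, l => ∑ s, w s * (forget p.2 d (joinList d (cellLinks p.1 s) l)).elim 0
      (listSum ps (d + p.2))

theorem getD_window {F : ℕ → ℕ} {d a : ℕ} (h : d ≤ a) (h' : a < 15) :
    (window F d).getD (a - d) 0 = F a := by
  have : a - d < 15 - d := by omega
  simp [window, List.getD_eq_getElem?_getD, this,
    Nat.add_sub_cancel' h]

theorem joinList_window {F : ℕ → ℕ} {d : ℕ} {M : List (ℕ × ℕ)}
    (hM : ∀ p ∈ M, (d ≤ p.1 ∧ p.1 < 15) ∧ (d ≤ p.2 ∧ p.2 < 15)) :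
    joinList d M (window F d) = window (mergeAll M F) d := by
  induction M generalizing F with
  | nil => rfl
  | cons q M ih =>
    obtain ⟨h1, h2⟩ := hM q List.mem_cons_self
    rw [mergeAll_cons, ← ih fun p hp => hM p (List.mem_cons_of_mem _ hp)]
    simp only [joinList, List.foldl_cons]
    congr 1
    rw [getD_window h1.1 h1.2, getD_window h2.1 h2.2]
    simp [window, merge, Function.comp_def]

theorem forget_window {F : ℕ → ℕ} (k : ℕ) {d : ℕ} (h : d + k ≤ 15) :
    (forget k d (window F d) = none ∧ ∃ x < d + k, F x = x) ∨
      (forget k d (window F d) = some (window F (d + k)) ∧ ∀ x, d ≤ x → x < d + k → F x ≠ x) := by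
  induction k generalizing d with
  | zero => exact Or.inr ⟨rfl, fun x h1 h2 => absurd h1 (by omega)⟩
  | succ k ih =>
    have hw : window F d = F d :: window F (d + 1) := by
      rw [window, show 15 - d = (15 - (d + 1)) + 1 by omega, List.range'_succ]; rfl
    rw [hw, forget]
    split_ifs with hd
    · exact Or.inl ⟨rfl, d, by omega, hd⟩
    · rw [show d + (k + 1) = d + 1 + k by omega]
      refine (ih (by omega)).imp id fun ⟨h1, h2⟩ => ⟨h1, fun x hx hx' => ?_⟩
      rcases hx.eq_or_lt with rfl | hx
      · exact hd
      · exact h2 x hx hx'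

theorem listSum_window {ps : List Cell} {d : ℕ} (hv : Valid d ps) {F : ℕ → ℕ}
    (hF : ∀ y, y ≤ F y) (hd : d ≤ 12) (hF' : ∀ x < d, F x ≠ x) :
    listSum w t ps d (window F d) = treeSum w t ps F := by
  induction ps generalizing F d with
  | nil =>
    cases hv
    have : Final t F ↔ window F 12 = outerLabels t := and_iff_right hF'
    simp only [listSum, treeSum, this]
  | cons p ps ih =>
    obtain ⟨h1, h2, h3⟩ := hv
    refine Finset.sum_congr rfl fun s _ => ?_
    rw [joinList_window (cellLinks_bound (P := fun x => d ≤ x ∧ x < 15) h1)]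
    have hle : ∀ y, y ≤ mergeAll (cellLinks p.1 s) F y :=
      fun y => (hF y).trans (le_mergeAll _ _ y)
    rcases forget_window (F := mergeAll (cellLinks p.1 s) F) p.2 (d := d) (by omega) with
      ⟨h, x, hx, hx'⟩ | ⟨h, hx⟩
    · rw [h, treeSum_eq_zero w t h3 hle hx h2 hx']
      rfl
    · rw [h]
      congr 1
      refine ih h3 hle h2 fun x hxd => ?_
      by_cases hxd' : d ≤ x
      · exact hx x hxd' hxd
      · have := lt_of_le_of_ne (hF x) (hF' x (by omega)).symm
        exact (this.trans_le (le_mergeAll _ _ x)).ne'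

end Sum

/-! ### Dynamic programming -/

/-- Lists of labels, with polynomials as multiplicities. -/
abbrev Table := List (List ℕ × Poly)

namespace Table

/-- Add an entry to a table. -/
def insert (l : List ℕ) (p : Poly) : Table → Table
  | [] => [(l, p)]
  | e :: T => if l = e.1 then (l, Poly.add p e.2) :: T else e :: insert l p T

/-- All states of a cell. -/
def states : List CellState := [all, solo 0, solo 1, solo 2, apart]

/-- Process a cell. -/
def step (c : Cell) (d : ℕ) (T : Table) : Table :=
  T.foldr (fun e acc => states.foldr (fun s acc =>
    (forget c.2 d (joinList d (cellLinks c.1 s) e.1)).elim acc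
      fun l => insert l (Poly.mulState s e.2) acc) acc) []

/-- Process a list of cells. -/
def run : List Cell → ℕ → Table → Table
  | [], _, T => T
  | c :: cs, d, T => run cs (d + c.2) (step c d T)

variable {R : Type*} [CommSemiring R] (f g h : R)

/-- The sum of a function over a table. -/
def total (φ : List ℕ → R) (T : Table) : R := (T.map fun e => Poly.eval f g h e.2 * φ e.1).sum

theorem total_insert (φ : List ℕ → R) (l : List ℕ) (p : Poly) (T : Table) :
    total f g h φ (insert l p T) = Poly.eval f g h p * φ l + total f g h φ T := by
  induction T with
  | nil => simp [insert, total]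
  | cons e T ih =>
    rw [insert]
    split_ifs with he
    · simp [total, he, Poly.eval_add]; ring
    · simp only [total, List.map_cons, List.sum_cons] at ih ⊢
      rw [ih]; ring

theorem total_step (t : CellState) (c : Cell) (cs : List Cell) (d : ℕ) (T : Table) :
    total f g h (listSum (weight f g h) t cs (d + c.2)) (step c d T) =
      total f g h (listSum (weight f g h) t (c :: cs) d) T := by
  induction T with
  | nil => rfl
  | cons e T ih =>
    rw [step, List.foldr_cons, ← step]
    have aux : ∀ (ss : List CellState) (acc : Table),
        total f g h (listSum (weight f g h) t cs (d + c.2)) (ss.foldr (fun s acc =>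
          (forget c.2 d (joinList d (cellLinks c.1 s) e.1)).elim acc
            fun l => insert l (Poly.mulState s e.2) acc) acc) =
        Poly.eval f g h e.2 * (ss.map fun s => s.weight f g h *
          (forget c.2 d (joinList d (cellLinks c.1 s) e.1)).elim 0
            (listSum (weight f g h) t cs (d + c.2))).sum +
        total f g h (listSum (weight f g h) t cs (d + c.2)) acc := by
      intro ss acc
      induction ss with
      | nil => simp
      | cons s ss ihs =>
        rw [List.foldr_cons, List.map_cons, List.sum_cons]
        cases forget c.2 d (joinList d (cellLinks c.1 s) e.1) with
        | none => simp [ihs]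
        | some l =>
          simp only [Option.elim_some, total_insert, ihs, Poly.eval_mulState]
          ring
    rw [aux, ih]
    simp only [total, List.map_cons, List.sum_cons, listSum, sum_eq, states, List.map_nil,
      List.sum_nil, add_zero]

theorem total_run (t : CellState) (cs : List Cell) (d : ℕ) (T : Table) :
    total f g h (listSum (weight f g h) t cs d) T =
      total f g h (fun l => if l = outerLabels t then 1 else 0) (run cs d T) := by
  induction cs generalizing d T with
  | nil => rfl
  | cons c cs ih => rw [run, ← ih, total_step]

end Table

/-- The cells of the gasket with four layers. The vertices are numbered in the order in which they
are forgotten, and `12`, `13`, `14` are the lower left, lower right and topmost vertex. -/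
def gasketCells : List Cell :=
  [(![0, 1, 14], 0), (![2, 3, 0], 1), (![3, 4, 1], 1), (![5, 7, 2], 1), (![7, 9, 3], 1),
    (![9, 11, 4], 1), (![12, 6, 5], 1), (![6, 8, 7], 2), (![8, 10, 9], 2), (![10, 13, 11], 2)]

/-- The result of the dynamic programming computation for the gasket with four layers. -/
def gasketTable : Table :=
  [([14, 13, 14],
      [[[0], [0], [], [], [], []], [[0], [0], [0], [0], [], [], []], [[0, 0], [0, 0], [0], [0], [0], [], []],
        [[0, 0], [0, 0], [0, 0], [0], [0], [], [], [13732]], [[0, 0, 0], [0, 0], [0, 0], [0], [0], [0, 14480], [16250]],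
        [[0, 0, 0], [0, 0], [0, 0], [0, 0, 2786], [0, 10609], [8015]],
        [[0, 0, 0], [0, 0, 0, 82], [0, 0, 1095], [0, 3130], [2148]], [[0, 0, 0, 12], [0, 0, 142], [0, 462], [332]],
        [[0, 0, 6], [0, 34], [28]], [[0, 1], [1]]]),
    ([12, 13, 14],
      [[[0], [0], [0], [0], [0], [], [], []], [[0, 0], [0, 0], [0, 0], [0], [0], [0], [], []],
        [[0, 0, 0], [0, 0], [0, 0], [0, 0], [0], [0], [], [], [42210]],
        [[0, 0, 0], [0, 0, 0], [0, 0], [0, 0], [0], [0], [0, 83234], [53826]],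
        [[0, 0, 0], [0, 0, 0], [0, 0], [0, 0], [0, 0, 30948], [0, 61422], [26934]],
        [[0, 0, 0], [0, 0, 0], [0, 0, 0, 2388], [0, 0, 12756], [0, 17763], [7113]],
        [[0, 0, 0, 0, 20], [0, 0, 0, 444], [0, 0, 1869], [0, 2558], [1068]], [[0, 0, 0, 15], [0, 0, 117], [0, 189], [87]],
        [[0, 0, 3], [0, 6], [3]]]),
    ([14, 14, 14],
      [[[], [], []], [[0], [], [], [], []], [[0], [0], [0], [], [], []], [[0, 0], [0], [0], [0], [], []],
        [[0, 0], [0, 0], [0], [0], [], [], [11354]], [[0, 0], [0, 0], [0], [0], [0, 5856], [13626]],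
        [[0, 0], [0, 0], [0, 0, 516], [0, 4140], [6936]], [[0, 0, 0, 2], [0, 0, 174], [0, 1140], [1928]],
        [[0, 0, 15], [0, 144], [309]], [[0, 7], [27]], [[1]]]),
    ([12, 14, 14],
      [[[], [], [], [], [], []], [[0], [0], [0], [0], [], [], []], [[0, 0], [0, 0], [0], [0], [0], [], []],
        [[0, 0], [0, 0], [0, 0], [0], [0], [], [], [13732]], [[0, 0, 0], [0, 0], [0, 0], [0], [0], [0, 14480], [16250]],
        [[0, 0, 0], [0, 0], [0, 0], [0, 0, 2786], [0, 10609], [8015]],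
        [[0, 0, 0], [0, 0, 0, 82], [0, 0, 1095], [0, 3130], [2148]], [[0, 0, 0, 12], [0, 0, 142], [0, 462], [332]],
        [[0, 0, 6], [0, 34], [28]], [[0, 1], [1]]]),
    ([13, 13, 14],
      [[[], [], [], [], [], []], [[0], [], [], [0], [], [], []], [[0], [0], [0], [0], [0], [], []],
        [[0, 0], [0, 0], [0, 0], [0], [0], [], [], [13732]], [[0, 0, 0], [0, 0], [0, 0], [0], [0], [0, 14480], [16250]],
        [[0, 0, 0], [0, 0], [0, 0], [0, 0, 2786], [0, 10609], [8015]],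
        [[0, 0, 0], [0, 0, 0, 82], [0, 0, 1095], [0, 3130], [2148]], [[0, 0, 0, 12], [0, 0, 142], [0, 462], [332]],
        [[0, 0, 6], [0, 34], [28]], [[0, 1], [1]]])]

set_option maxRecDepth 100000 in
theorem run_gasketCells :
    Table.run gasketCells 0 [(List.range 15, [[[1]]])] = gasketTable := by
  decide +kernel

theorem valid_gasketCells : Valid 0 gasketCells := by
  simp only [gasketCells, Valid]
  decide

variable {R : Type*} [CommSemiring R]

theorem treeSum_gasketCells (f g h : R) (t : CellState) :
    treeSum (weight f g h) t gasketCells id =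
      Table.total f g h (fun l => if l = outerLabels t then 1 else 0) gasketTable := by
  rw [← run_gasketCells, ← Table.total_run,
    ← listSum_window (F := id) _ _ valid_gasketCells (fun y => le_rfl) (by norm_num) (by simp)]
  simp [Table.total, Poly.eval, evalList, window, List.range_eq_range']

theorem treeSum_all (f g h : R) :
    treeSum (weight f g h) all gasketCells id =
    f ^ 10 + 27 * f ^ 9 * g + 7 * f ^ 9 * h + 309 * f ^ 8 * g ^ 2 + 144 * f ^ 8 * g * h
      + 1928 * f ^ 7 * g ^ 3 + 15 * f ^ 8 * h ^ 2 + 1140 * f ^ 7 * g ^ 2 * h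
      + 6936 * f ^ 6 * g ^ 4 + 174 * f ^ 7 * g * h ^ 2 + 4140 * f ^ 6 * g ^ 3 * h
      + 13626 * f ^ 5 * g ^ 5 + 2 * f ^ 7 * h ^ 3 + 516 * f ^ 6 * g ^ 2 * h ^ 2
      + 5856 * f ^ 5 * g ^ 4 * h + 11354 * f ^ 4 * g ^ 6 := by
  rw [treeSum_gasketCells]
  simp [Table.total, gasketTable, outerLabels, Poly.eval, evalList]
  ring

theorem treeSum_solo (f g h : R) (i : Fin 3) :
    treeSum (weight f g h) (solo i) gasketCells id =
    f ^ 9 * g + f ^ 9 * h + 28 * f ^ 8 * g ^ 2 + 34 * f ^ 8 * g * h + 332 * f ^ 7 * g ^ 3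
      + 6 * f ^ 8 * h ^ 2 + 462 * f ^ 7 * g ^ 2 * h + 2148 * f ^ 6 * g ^ 4
      + 142 * f ^ 7 * g * h ^ 2 + 3130 * f ^ 6 * g ^ 3 * h + 8015 * f ^ 5 * g ^ 5
      + 12 * f ^ 7 * h ^ 3 + 1095 * f ^ 6 * g ^ 2 * h ^ 2 + 10609 * f ^ 5 * g ^ 4 * h
      + 16250 * f ^ 4 * g ^ 6 + 82 * f ^ 6 * g * h ^ 3 + 2786 * f ^ 5 * g ^ 3 * h ^ 2
      + 14480 * f ^ 4 * g ^ 5 * h + 13732 * f ^ 3 * g ^ 7 := by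
  rw [treeSum_gasketCells]
  fin_cases i <;>
  · simp [Table.total, gasketTable, outerLabels, Poly.eval, evalList]
    ring

theorem treeSum_apart (f g h : R) :
    treeSum (weight f g h) apart gasketCells id =
    3 * f ^ 8 * g ^ 2 + 6 * f ^ 8 * g * h + 87 * f ^ 7 * g ^ 3 + 3 * f ^ 8 * h ^ 2
      + 189 * f ^ 7 * g ^ 2 * h + 1068 * f ^ 6 * g ^ 4 + 117 * f ^ 7 * g * h ^ 2
      + 2558 * f ^ 6 * g ^ 3 * h + 7113 * f ^ 5 * g ^ 5 + 15 * f ^ 7 * h ^ 3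
      + 1869 * f ^ 6 * g ^ 2 * h ^ 2 + 17763 * f ^ 5 * g ^ 4 * h + 26934 * f ^ 4 * g ^ 6
      + 444 * f ^ 6 * g * h ^ 3 + 12756 * f ^ 5 * g ^ 3 * h ^ 2 + 61422 * f ^ 4 * g ^ 5 * h
      + 53826 * f ^ 3 * g ^ 7 + 20 * f ^ 6 * h ^ 4 + 2388 * f ^ 5 * g ^ 2 * h ^ 3
      + 30948 * f ^ 4 * g ^ 4 * h ^ 2 + 83234 * f ^ 3 * g ^ 6 * h + 42210 * f ^ 2 * g ^ 8 := by
  rw [treeSum_gasketCells]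
  simp [Table.total, gasketTable, outerLabels, Poly.eval, evalList]
  ring

/-! ### Gluing graphs at their outmost vertices -/

/-- Every vertex of `H` is connected to one of the vertices `k i`, which are connected to each other
as described by `s`. -/
def HasState {V : Type*} (H : SimpleGraph V) (k : Fin 3 → V) (s : CellState) : Prop :=
  (∀ v, ∃ i, H.Reachable v (k i)) ∧ ∀ i j, H.Reachable (k i) (k j) ↔ s.rel i j

/-- The number of subgraphs of `G` in a given state. -/
noncomputable def stateCount {V : Type*} (G : SimpleGraph V) (k : Fin 3 → V) (s : CellState) : ℕ :=
  {H : SimpleGraph V | H ≤ G ∧ HasState H k s}.ncard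

theorem HasState.unique {V : Type*} {H : SimpleGraph V} {k : Fin 3 → V} {s s' : CellState}
    (h : HasState H k s) (h' : HasState H k s') : s = s' := by
  have : ∀ i j, s.rel i j = s'.rel i j := fun i j =>
    Bool.eq_iff_iff.2 ((h.2 i j).symm.trans (h'.2 i j))
  revert this
  clear h h'
  revert s s'
  decide

theorem exists_hasState {V : Type*} {H : SimpleGraph V} {k : Fin 3 → V}
    (h : ∀ v, ∃ i, H.Reachable v (k i)) : ∃ s, HasState H k s := by
  classical
  have key : ∀ r : Fin 3 → Fin 3 → Bool, (∀ i, r i i) → (∀ i j, r i j → r j i) →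
      (∀ i j l, r i j → r j l → r i l) → ∃ s : CellState, ∀ i j, r i j = s.rel i j := by
    intro r h1 h2 h3
    have e01 : r 1 0 = r 0 1 := Bool.eq_iff_iff.2 ⟨h2 _ _, h2 _ _⟩
    have e02 : r 2 0 = r 0 2 := Bool.eq_iff_iff.2 ⟨h2 _ _, h2 _ _⟩
    have e12 : r 2 1 = r 1 2 := Bool.eq_iff_iff.2 ⟨h2 _ _, h2 _ _⟩
    have a := h3 0 1 2
    have b := h3 1 0 2
    have c := h3 0 2 1
    have d0 := h1 0
    have d1 := h1 1
    have d2 := h1 2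
    rw [e01] at b
    rw [e12] at c
    cases u : r 0 1 <;> cases v : r 0 2 <;> cases w : r 1 2 <;> simp_all
    · exact ⟨apart, by simp [Fin.forall_fin_succ, rel, *]⟩
    · exact ⟨solo 0, by simp [Fin.forall_fin_succ, rel, *]⟩
    · exact ⟨solo 1, by simp [Fin.forall_fin_succ, rel, *]⟩
    · exact ⟨solo 2, by simp [Fin.forall_fin_succ, rel, *]⟩
    · exact ⟨all, by simp [Fin.forall_fin_succ, rel, *]⟩
  obtain ⟨s, hs⟩ := key (fun i j => decide (H.Reachable (k i) (k j))) (by simp)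
    (fun i j => by simpa using SimpleGraph.Reachable.symm)
    (fun i j l => by simpa using SimpleGraph.Reachable.trans)
  exact ⟨s, h, fun i j => by simp [← hs]⟩

theorem reachable_induction {V : Type*} {H : SimpleGraph V} (p : V → Prop)
    (hp : ∀ u v, H.Adj u v → p u → p v) {u v : V} (h : H.Reachable u v) (hu : p u) : p v := by
  obtain ⟨w⟩ := h
  induction w with
  | nil => exact hu
  | cons hadj _ ih => exact ih (hp _ _ hadj hu)

/-- Copies of a graph on `V` in a graph on `W`, one for each cell of a list, where different copies
share at most one vertex, which is an outmost vertex of both. -/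
structure Gluing {V W : Type*} (ps : List Cell) (k : Fin 3 → V) where
  /-- the embeddings of the copies -/
  φ : Fin ps.length → V ↪ W
  /-- the vertices of the cells -/
  p : ℕ → W
  cover : ∀ x, ∃ c y, φ c y = x
  eq_of_lt : ∀ x < 15, ∀ y < 15, p x = p y → x = y
  corner : ∀ c i, φ c (k i) = p ((ps.get c).1 i)
  bound : ∀ c i, (ps.get c).1 i < 15
  exists_cell : ∀ x < 15, ∃ c i, (ps.get c).1 i = x
  shared : ∀ c c', c ≠ c' → ∀ y y', φ c y = φ c' y' → ∃ i, y = k i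
  shared_unique : ∀ c c', c ≠ c' → ∀ y y' z z', φ c y = φ c' y' → φ c z = φ c' z' → y = z

namespace Gluing

variable {V W : Type*} {ps : List Cell} {k : Fin 3 → V} (Γ : Gluing (W := W) ps k)

/-- The outmost vertices of the glued graph. -/
def outer (i : Fin 3) : W := Γ.p (12 + i)

/-- The union of graphs on the copies. -/
def glue (Hs : Fin ps.length → SimpleGraph V) : SimpleGraph W := ⨆ c, (Hs c).map (Γ.φ c)

theorem glue_adj {Hs : Fin ps.length → SimpleGraph V} {x y : W} :
    (Γ.glue Hs).Adj x y ↔ ∃ c u v, (Hs c).Adj u v ∧ Γ.φ c u = x ∧ Γ.φ c v = y := by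
  simp [glue, SimpleGraph.iSup_adj, SimpleGraph.map_adj]

theorem comap_glue (Hs : Fin ps.length → SimpleGraph V) (c : Fin ps.length) :
    (Γ.glue Hs).comap (Γ.φ c) = Hs c := by
  ext u v
  rw [SimpleGraph.comap_adj, glue_adj]
  constructor
  · rintro ⟨c', u', v', h, hu, hv⟩
    by_cases hc : c' = c
    · subst hc
      rwa [← (Γ.φ c').injective hu, ← (Γ.φ c').injective hv]
    · exact absurd (Γ.shared_unique c' c hc _ _ _ _ hu hv) h.ne
  · exact fun h => ⟨c, u, v, h, rfl, rfl⟩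

theorem glue_injective : Function.Injective Γ.glue := fun Hs Hs' h => by
  ext1 c
  rw [← Γ.comap_glue Hs, h, comap_glue]

theorem glue_mono {Hs Hs' : Fin ps.length → SimpleGraph V} (h : ∀ c, Hs c ≤ Hs' c) :
    Γ.glue Hs ≤ Γ.glue Hs' := by
  intro x y hxy
  obtain ⟨c, u, v, h', hu, hv⟩ := Γ.glue_adj.1 hxy
  exact Γ.glue_adj.2 ⟨c, u, v, h c h', hu, hv⟩

theorem glue_le_iff {Hs Hs' : Fin ps.length → SimpleGraph V} :
    Γ.glue Hs ≤ Γ.glue Hs' ↔ ∀ c, Hs c ≤ Hs' c := by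
  refine ⟨fun h c => ?_, Γ.glue_mono⟩
  rw [← Γ.comap_glue Hs, ← Γ.comap_glue Hs']
  exact fun _ _ h' => h h'

theorem exists_eq_glue {Hs : Fin ps.length → SimpleGraph V} {H : SimpleGraph W}
    (h : H ≤ Γ.glue Hs) : ∃ Hs', H = Γ.glue Hs' := by
  refine ⟨fun c => H.comap (Γ.φ c), ?_⟩
  ext x y
  rw [glue_adj]
  constructor
  · intro hxy
    obtain ⟨c, u, v, -, rfl, rfl⟩ := Γ.glue_adj.1 (h hxy)
    exact ⟨c, u, v, hxy, rfl, rfl⟩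
  · rintro ⟨c, u, v, huv, rfl, rfl⟩
    exact huv

theorem reachable_glue {Hs : Fin ps.length → SimpleGraph V} {c : Fin ps.length} {u v : V}
    (h : (Hs c).Reachable u v) : (Γ.glue Hs).Reachable (Γ.φ c u) (Γ.φ c v) :=
  h.map ⟨Γ.φ c, fun h => Γ.glue_adj.2 ⟨c, _, _, h, rfl, rfl⟩⟩

/-- The labels of the vertices of the cells, for given states of the cells. -/
def labels (ps : List Cell) (s : Fin ps.length → CellState) : ℕ → ℕ := mergeAll (allLinks ps s) id

theorem le_labels {s : Fin ps.length → CellState} (x : ℕ) : x ≤ labels ps s x :=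
  le_mergeAll _ id x

theorem labels_labels {s : Fin ps.length → CellState} (x : ℕ) :
    labels ps s (labels ps s x) = labels ps s x :=
  mergeAll_idem _ (fun _ => rfl) x

include Γ in
theorem labels_lt {s : Fin ps.length → CellState} {x : ℕ} (hx : x < 15) : labels ps s x < 15 := by
  refine mergeAll_lt (fun _ => id) (fun q hq => ?_) hx
  obtain ⟨c, hc⟩ := mem_allLinks.1 hq
  exact cellLinks_bound (P := (· < 15)) (Γ.bound c) q hc

theorem labels_eq_of_rel {s : Fin ps.length → CellState} {c : Fin ps.length} {i j : Fin 3}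
    (h : (s c).rel i j) : labels ps s ((ps.get c).1 i) = labels ps s ((ps.get c).1 j) :=
  eq_of_rel_of_cellLinks (fun _ hp => mergeAll_complete (mem_allLinks.2 ⟨c, hp⟩)) h

theorem reachable_iff {Hs : Fin ps.length → SimpleGraph V} {s : Fin ps.length → CellState}
    (hs : ∀ c, HasState (Hs c) k (s c)) {x y : ℕ} (hx : x < 15) (hy : y < 15) :
    (Γ.glue Hs).Reachable (Γ.p x) (Γ.p y) ↔ labels ps s x = labels ps s y := by
  constructor
  · intro h
    have key := reachable_induction (fun w => ∀ c u i, Γ.φ c u = w → (Hs c).Reachable u (k i) →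
      labels ps s ((ps.get c).1 i) = labels ps s x) ?_ h ?_
    · obtain ⟨c, i, rfl⟩ := Γ.exists_cell y hy
      exact (key c (k i) i (Γ.corner c i) (.refl _)).symm
    · intro w w' hadj hw c' u' i hu' hr
      obtain ⟨c, u, v, huv, rfl, rfl⟩ := Γ.glue_adj.1 hadj
      by_cases hc : c' = c
      · subst hc
        rw [(Γ.φ c').injective hu'] at hr
        exact hw c' u i rfl (huv.reachable.trans hr)
      · obtain ⟨a, rfl⟩ := Γ.shared c' c hc _ _ hu'
        obtain ⟨b, rfl⟩ := Γ.shared c c' (Ne.symm hc) _ _ hu'.symm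
        rw [← labels_eq_of_rel (((hs c').2 a i).1 hr), ← hw c u b rfl huv.reachable]
        rw [Γ.corner, Γ.corner] at hu'
        rw [Γ.eq_of_lt _ (Γ.bound _ _) _ (Γ.bound _ _) hu']
    · intro c u i hu hr
      obtain ⟨c', j, rfl⟩ := Γ.exists_cell x hx
      rw [← Γ.corner] at hu
      have : ∃ a, u = k a := by
        by_cases hc : c = c'
        · subst hc
          exact ⟨j, (Γ.φ c).injective hu⟩
        · exact Γ.shared c c' hc _ _ hu
      obtain ⟨a, rfl⟩ := this
      rw [← labels_eq_of_rel (((hs c).2 a i).1 hr)]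
      rw [Γ.corner, Γ.corner] at hu
      rw [Γ.eq_of_lt _ (Γ.bound _ _) _ (Γ.bound _ _) hu]
  · refine mergeAll_sound ((Γ.glue Hs).reachableSetoid.comap Γ.p) ?_ ?_ x y
    · rintro x y rfl
      exact Setoid.refl' _ x
    · intro q hq
      obtain ⟨c, hc⟩ := mem_allLinks.1 hq
      obtain ⟨i, j, hij, rfl⟩ := mem_cellLinks hc
      have := Γ.reachable_glue (((hs c).2 i j).2 hij)
      rwa [Γ.corner, Γ.corner] at this

theorem exists_reachable {Hs : Fin ps.length → SimpleGraph V}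
    (h : ∀ w, ∃ i, (Γ.glue Hs).Reachable w (Γ.outer i)) (c : Fin ps.length) (v : V) :
    ∃ i, (Hs c).Reachable v (k i) := by
  by_contra! hv
  obtain ⟨i, hi⟩ := h (Γ.φ c v)
  have step : ∀ w w', (Γ.glue Hs).Adj w w' → (∃ u, Γ.φ c u = w ∧ (Hs c).Reachable v u) →
      ∃ u, Γ.φ c u = w' ∧ (Hs c).Reachable v u := by
    rintro w w' hadj ⟨u, rfl, hr⟩
    obtain ⟨c', u', v', huv, hu, rfl⟩ := Γ.glue_adj.1 hadj
    by_cases hc : c = c'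
    · subst hc
      rw [(Γ.φ c).injective hu] at huv
      exact ⟨v', rfl, hr.trans huv.reachable⟩
    · obtain ⟨a, rfl⟩ := Γ.shared c c' hc _ _ hu.symm
      exact absurd hr (hv a)
  obtain ⟨u, hu, hr⟩ := reachable_induction _ step hi ⟨v, rfl, .refl _⟩
  obtain ⟨c', j, hj⟩ := Γ.exists_cell (12 + i) (by omega)
  rw [outer, ← hj, ← Γ.corner] at hu
  by_cases hc : c = c'
  · subst hc
    exact hv j ((Γ.φ c).injective hu ▸ hr)
  · obtain ⟨a, rfl⟩ := Γ.shared c c' hc _ _ hu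
    exact hv a hr

theorem outerLabels_iff {F : ℕ → ℕ} (hF : ∀ x, x ≤ F x) (hF' : ∀ x, F (F x) = F x)
    (hlt : ∀ x < 15, F x < 15) (t : CellState) :
    [F 12, F 13, F 14] = outerLabels t ↔
      ∀ i j : Fin 3, (F (12 + i) = F (12 + j) ↔ t.rel i j) := by
  have a0 := hF 12
  have a1 := hF 13
  have a2 := hF 14
  have b0 := hlt 12 (by norm_num)
  have b1 := hlt 13 (by norm_num)
  have b2 := hlt 14 (by norm_num)
  have c0 := hF' 12
  have e2 : F 14 = 14 := by omega
  obtain e1 | e1 : F 13 = 13 ∨ F 13 = 14 := by omega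
  all_goals
    obtain e0 | e0 | e0 : F 12 = 12 ∨ F 12 = 13 ∨ F 12 = 14 := by omega
    all_goals
      rw [e0] at c0
      first
        | omega
        | rcases t with _ | i | _
          · simp [Fin.forall_fin_succ, rel, outerLabels, e0, e1, e2]
          · fin_cases i <;> simp [Fin.forall_fin_succ, rel, outerLabels, e0, e1, e2]
          · simp [Fin.forall_fin_succ, rel, outerLabels, e0, e1, e2]

theorem hasState_glue_iff {Hs : Fin ps.length → SimpleGraph V} {t : CellState} :
    HasState (Γ.glue Hs) Γ.outer t ↔
      ∃ s : Fin ps.length → CellState, Final t (labels ps s) ∧ ∀ c, HasState (Hs c) k (s c) := by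
  have main : ∀ s : Fin ps.length → CellState, (∀ c, HasState (Hs c) k (s c)) →
      (HasState (Γ.glue Hs) Γ.outer t ↔ Final t (labels ps s)) := by
    intro s hs
    refine and_congr ?_ ?_
    · constructor
      · intro h x hx hfix
        obtain ⟨i, hi⟩ := h (Γ.p x)
        rw [outer, Γ.reachable_iff hs (by omega) (by omega), hfix] at hi
        have := le_labels (s := s) (12 + i)
        omega
      · intro h w
        obtain ⟨c, v, rfl⟩ := Γ.cover w
        obtain ⟨i, hi⟩ := (hs c).1 v
        have hb := Γ.bound c i
        set x := (ps.get c).1 i with hx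
        have h1 : labels ps s x < 15 := Γ.labels_lt hb
        have h2 : 12 ≤ labels ps s x := by
          by_contra! h2
          exact h _ h2 (labels_labels x)
        refine ⟨⟨labels ps s x - 12, by omega⟩, ?_⟩
        have h3 := Γ.reachable_glue hi
        rw [Γ.corner, ← hx] at h3
        refine h3.trans ?_
        simp only [outer, Nat.add_sub_cancel' h2]
        exact (Γ.reachable_iff hs hb h1).2 (labels_labels x).symm
    · rw [outerLabels_iff le_labels labels_labels (fun x => Γ.labels_lt)]
      refine forall_congr' fun i => forall_congr' fun j => ?_
      rw [outer, outer, Γ.reachable_iff hs (by omega) (by omega)]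
  constructor
  · intro h
    choose s hs using fun c => exists_hasState (Γ.exists_reachable h.1 c)
    exact ⟨s, (main s hs).1 h, hs⟩
  · rintro ⟨s, h, hs⟩
    exact (main s hs).2 h

theorem stateCount_glue [Finite V] [Finite W] (G : SimpleGraph V) (t : CellState) :
    stateCount (Γ.glue fun _ => G) Γ.outer t = treeSum (stateCount G k) t ps id := by
  classical
  have := Fintype.ofFinite V
  have := Fintype.ofFinite W
  rw [treeSum_eq_sum]
  let A : CellState → Finset (SimpleGraph V) := fun s => {H | H ≤ G ∧ HasState H k s}
  have hA : ∀ s, stateCount G k s = (A s).card := fun s => by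
    rw [stateCount, Set.ncard_eq_toFinset_card']
    simp [A]
  let S : Finset (Fin ps.length → CellState) := {s | Final t (labels ps s)}
  have h1 : {H : SimpleGraph W | H ≤ Γ.glue (fun _ => G) ∧ HasState H Γ.outer t} =
      Γ.glue '' ((S.biUnion fun s => Fintype.piFinset fun c => A (s c) : Finset _) : Set _) := by
    ext H
    simp only [Set.mem_ofPred_eq, Set.mem_image, Finset.mem_coe, Finset.mem_biUnion,
      Fintype.mem_piFinset, S, A, Finset.mem_filter, Finset.mem_univ, true_and]
    constructor
    · rintro ⟨hle, hH⟩
      obtain ⟨Hs, rfl⟩ := Γ.exists_eq_glue hle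
      obtain ⟨s, hf, hs⟩ := Γ.hasState_glue_iff.1 hH
      exact ⟨Hs, ⟨s, hf, fun c => ⟨Γ.glue_le_iff.1 hle c, hs c⟩⟩, rfl⟩
    · rintro ⟨Hs, ⟨s, hf, hs⟩, rfl⟩
      exact ⟨Γ.glue_mono fun c => (hs c).1, Γ.hasState_glue_iff.2 ⟨s, hf, fun c => (hs c).2⟩⟩
  rw [stateCount, h1, Set.ncard_image_of_injective _ Γ.glue_injective, Set.ncard_coe_finset,
    Finset.card_biUnion]
  · simp only [Fintype.card_piFinset, S, Finset.sum_filter, hA]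
    exact Finset.sum_congr rfl fun s _ => by
      simp only [labels, mul_ite, mul_one, mul_zero]
      congr
  · intro s _ s' _ hne
    refine Finset.disjoint_left.2 fun Hs h h' => hne (funext fun c => ?_)
    simp only [Fintype.mem_piFinset, A, Finset.mem_filter] at h h'
    exact (h c).2.2.unique (h' c).2.2

end Gluing

/-! ### The counts in terms of states -/

/-- The outmost vertices. -/
def outmost (b n : ℕ) [NeZero b] : Fin 3 → verts b n := ![left b n, right b n, top b n]

theorem outmost_injective (b n : ℕ) [NeZero b] : Function.Injective (outmost b n) := by
  have hb : b ^ n ≠ 0 := pow_ne_zero n (NeZero.ne b)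
  intro i j hij
  have := congrArg Subtype.val hij
  fin_cases i <;> fin_cases j <;> first
    | rfl
    | exact absurd this (by simp [outmost, left, right, top, hb.symm, NeZero.ne b])

section Counts

variable {V : Type*} {H : SimpleGraph V} {k : Fin 3 → V}

theorem forall_exists_reachable_iff [Finite V] :
    (∀ v, ∃ i, H.Reachable v (k i)) ↔
      Nat.card H.ConnectedComponent = (Set.range fun i => H.connectedComponentMk (k i)).ncard := by
  have : Finite H.ConnectedComponent := Quot.finite _
  rw [← Set.ncard_univ]
  constructor
  · intro h
    congr 1
    refine (Set.eq_univ_of_forall fun c => ?_).symm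
    induction c using SimpleGraph.ConnectedComponent.ind with
    | _ v =>
      obtain ⟨i, hi⟩ := h v
      exact ⟨i, (SimpleGraph.ConnectedComponent.sound hi).symm⟩
  · intro h v
    have := Set.eq_of_subset_of_ncard_le (Set.subset_univ _) h.le
    obtain ⟨i, hi⟩ := this.ge (Set.mem_univ (H.connectedComponentMk v))
    exact ⟨i, (SimpleGraph.ConnectedComponent.exact hi).symm⟩

theorem hasState_all_iff : HasState H k all ↔ H.Connected := by
  rw [SimpleGraph.connected_iff]
  constructor
  · rintro ⟨h1, h2⟩
    refine ⟨fun u v => ?_, ⟨k 0⟩⟩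
    obtain ⟨i, hi⟩ := h1 u
    obtain ⟨j, hj⟩ := h1 v
    exact (hi.trans ((h2 i j).2 rfl)).trans hj.symm
  · rintro ⟨h, -⟩
    exact ⟨fun v => ⟨0, h _ _⟩, fun i j => iff_of_true (h _ _) rfl⟩

theorem hasState_solo_two_iff [Finite V] : HasState H k (solo 2) ↔
    Nat.card H.ConnectedComponent = 2 ∧ H.Reachable (k 0) (k 1) ∧ ¬ H.Reachable (k 2) (k 0) := by
  have key : (∀ i j, H.Reachable (k i) (k j) ↔ (solo 2).rel i j) ↔
      H.Reachable (k 0) (k 1) ∧ ¬ H.Reachable (k 2) (k 0) := by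
    constructor
    · intro h
      exact ⟨(h 0 1).2 rfl, fun h' => by simpa [rel] using (h 2 0).1 h'⟩
    · rintro ⟨h1, h2⟩
      have h3 : ¬ H.Reachable (k 2) (k 1) := fun h => h2 (h.trans h1.symm)
      have h4 : ¬ H.Reachable (k 0) (k 2) := fun h => h2 h.symm
      have h5 : ¬ H.Reachable (k 1) (k 2) := fun h => h3 h.symm
      simp [Fin.forall_fin_succ, rel, h1, h2, h3, h4, h5, h1.symm]
  rw [HasState, key, forall_exists_reachable_iff]
  refine and_congr_left fun ⟨h1, h2⟩ => ?_
  have : (Set.range fun i => H.connectedComponentMk (k i)) =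
      {H.connectedComponentMk (k 2), H.connectedComponentMk (k 0)} := by
    ext c
    simp [Fin.exists_fin_succ, ← SimpleGraph.ConnectedComponent.sound h1, eq_comm]
    tauto
  rw [this, Set.ncard_pair fun h => h2 (SimpleGraph.ConnectedComponent.exact h)]

theorem hasState_apart_iff [Finite V] : HasState H k apart ↔
    Nat.card H.ConnectedComponent = 3 ∧ ¬ H.Reachable (k 0) (k 1) ∧ ¬ H.Reachable (k 2) (k 0) ∧
      ¬ H.Reachable (k 2) (k 1) := by
  have key : (∀ i j, H.Reachable (k i) (k j) ↔ apart.rel i j) ↔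
      ¬ H.Reachable (k 0) (k 1) ∧ ¬ H.Reachable (k 2) (k 0) ∧ ¬ H.Reachable (k 2) (k 1) := by
    simp only [Fin.forall_fin_succ, rel]
    simp [SimpleGraph.reachable_comm (u := k 1) (v := k 0), SimpleGraph.reachable_comm (u := k 2)]
    tauto
  rw [HasState, key, forall_exists_reachable_iff]
  refine and_congr_left fun h => ?_
  have : Function.Injective fun i => H.connectedComponentMk (k i) := by
    intro i j hij
    have h' := (key.2 h i j).1 (SimpleGraph.ConnectedComponent.exact hij)
    simpa [rel] using h'
  rw [← Set.image_univ, Set.ncard_image_of_injective _ this, Set.ncard_univ]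
  simp

end Counts

theorem f_eq (b n : ℕ) [NeZero b] : f b n = stateCount (SG b n) (outmost b n) all := by
  simp only [f, numCSSG, stateCount, hasState_all_iff]

theorem g_eq (b n : ℕ) [NeZero b] : g b n = stateCount (SG b n) (outmost b n) (solo 2) := by
  simp only [g, stateCount, hasState_solo_two_iff]
  rfl

theorem h_eq (b n : ℕ) [NeZero b] : h b n = stateCount (SG b n) (outmost b n) apart := by
  simp only [h, stateCount, hasState_apart_iff]
  rfl

/-! ### The triangle -/

theorem stateCount_comap {V W : Type*} (e : V ≃ W) (k : Fin 3 → V) (s : CellState) :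
    stateCount (⊤ : SimpleGraph W) (e ∘ k) s = stateCount (⊤ : SimpleGraph V) k s := by
  simp only [stateCount, le_top, true_and]
  refine Set.ncard_congr (fun H _ => H.comap e) ?_ ?_ ?_
  · rintro H ⟨h1, h2⟩
    have key : ∀ u v, (H.comap e).Reachable u v ↔ H.Reachable (e u) (e v) := fun u v =>
      (SimpleGraph.Iso.comap e H).reachable_iff.symm
    exact ⟨fun v => by simpa only [key, Function.comp_apply] using h1 (e v), fun i j => by simpa only [key, Function.comp_apply] using h2 i j⟩
  · intro H H' _ _ h
    ext u v
    have := congrArg (fun K : SimpleGraph V => K.Adj (e.symm u) (e.symm v)) h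
    simpa using this
  · rintro H ⟨h1, h2⟩
    have hH : (H.comap e.symm).comap e = H := by ext; simp
    have key : ∀ u v, H.Reachable u v ↔ (H.comap e.symm).Reachable (e u) (e v) := fun u v => by
      conv_lhs => rw [← hH]
      exact (SimpleGraph.Iso.comap e (H.comap e.symm)).reachable_iff.symm
    refine ⟨H.comap e.symm, ⟨fun w => ?_, fun i j => ?_⟩, hH⟩
    · simpa only [key, e.apply_symm_apply, Function.comp_apply] using h1 (e.symm w)
    · simpa only [key, Function.comp_apply] using h2 i j

instance {V : Type*} [Fintype V] [DecidableEq V] (H : SimpleGraph V) [DecidableRel H.Adj]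
    (k : Fin 3 → V) (s : CellState) : Decidable (HasState H k s) :=
  inferInstanceAs (Decidable ((∀ v, ∃ i, H.Reachable v (k i)) ∧
    ∀ i j, H.Reachable (k i) (k j) ↔ s.rel i j))

instance {V : Type*} (x : {adj : V → V → Bool // (∀ x y, adj x y = adj y x) ∧ ∀ x, ¬ adj x x}) :
    DecidableRel (SimpleGraph.mk' x).Adj :=
  fun u v => inferInstanceAs (Decidable (x.1 u v = true))

theorem card_triangle_states (s : CellState) :
    (Finset.univ.filter fun x : {adj : Fin 3 → Fin 3 → Bool //
      (∀ x y, adj x y = adj y x) ∧ ∀ x, ¬ adj x x} => HasState (SimpleGraph.mk' x) id s).card =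
        weight 4 1 1 s := by
  revert s
  decide +kernel

theorem stateCount_triangle (s : CellState) :
    stateCount (⊤ : SimpleGraph (Fin 3)) id s = weight 4 1 1 s := by
  have h1 : {H : SimpleGraph (Fin 3) | H ≤ ⊤ ∧ HasState H id s} =
      SimpleGraph.mk' '' {x | HasState (SimpleGraph.mk' x) id s} := by
    ext H
    have : ∃ x, SimpleGraph.mk' x = H := by
      obtain ⟨x, -, hx⟩ := Finset.mem_map.1 (Fintype.complete H)
      exact ⟨x, hx⟩
    obtain ⟨x, rfl⟩ := this
    simp
  rw [stateCount, h1, Set.ncard_image_of_injective _ SimpleGraph.mk'.injective,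
    Set.ncard_eq_toFinset_card', Set.toFinset_ofPred,
    ← card_triangle_states]

theorem stateCount_zero (b : ℕ) [NeZero b] (s : CellState) :
    stateCount (SG b 0) (outmost b 0) s = weight 4 1 1 s := by
  have hb : Function.Bijective (outmost b 0) := by
    refine ⟨outmost_injective b 0, ?_⟩
    rintro ⟨v, hv⟩
    simp only [verts, Finset.mem_insert, Finset.mem_singleton] at hv
    rcases hv with rfl | rfl | rfl
    · exact ⟨0, rfl⟩
    · exact ⟨1, by simp [outmost, right]⟩
    · exact ⟨2, by simp [outmost, top]⟩
  have hG : SG b 0 = ⊤ := by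
    ext u v
    simp only [SG, latticeGraph, SimpleGraph.comap_adj, SimpleGraph.fromRel_adj, u.2, v.2,
      SimpleGraph.top_adj, ne_eq, Subtype.ext_iff, and_self, or_self, and_true]
  rw [hG, ← stateCount_triangle, ← stateCount_comap (Equiv.ofBijective _ hb)]
  rfl

/-! ### The copies of a gasket inside the next one -/

theorem place_apply (b n : ℕ) (c v : ℕ × ℕ) :
    place b n c v = (b ^ n * c.1 + v.1, b ^ n * c.2 + v.2) := rfl

theorem add_le_of_mem_verts {b n : ℕ} [NeZero b] {v : ℕ × ℕ} (h : v ∈ verts b n) :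
    v.1 + v.2 ≤ b ^ n := by
  induction n generalizing v with
  | zero =>
    simp only [verts, Finset.mem_insert, Finset.mem_singleton] at h
    rcases h with rfl | rfl | rfl <;> simp
  | succ n ih =>
    simp only [verts, Finset.mem_biUnion, Finset.mem_map] at h
    obtain ⟨c, hc, u, hu, rfl⟩ := h
    have h1 := ih hu
    have h2 : c.1 + c.2 + 1 ≤ b := by
      simp only [cells, Finset.mem_filter] at hc
      exact hc.2
    have h3 := Nat.mul_le_mul_left (b ^ n) h2
    rw [place_apply, pow_succ]
    dsimp only
    linarith

theorem mem_verts_of_adj {b n : ℕ} {u v : ℕ × ℕ} (h : (latticeGraph b n).Adj u v) :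
    u ∈ verts b n ∧ v ∈ verts b n := by
  induction n generalizing u v with
  | zero =>
    simp only [latticeGraph, SimpleGraph.fromRel_adj] at h
    tauto
  | succ n ih =>
    simp only [latticeGraph, SimpleGraph.iSup_adj, SimpleGraph.map_adj] at h
    obtain ⟨c, hc, u', v', h', rfl, rfl⟩ := h
    obtain ⟨h1, h2⟩ := ih h'
    exact ⟨Finset.mem_biUnion.2 ⟨c, hc, Finset.mem_map_of_mem _ h1⟩,
      Finset.mem_biUnion.2 ⟨c, hc, Finset.mem_map_of_mem _ h2⟩⟩

theorem place_mem {b n : ℕ} {c v : ℕ × ℕ} (hc : c ∈ cells b) (hv : v ∈ verts b n) :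
    place b n c v ∈ verts b (n + 1) :=
  Finset.mem_biUnion.2 ⟨c, hc, Finset.mem_map_of_mem _ hv⟩

/-- The common vertex of two different copies, relative to the first one. -/
theorem eq_of_place_eq {L : ℕ} {c c' u v : ℕ × ℕ} (hc : c ≠ c') (hu : u.1 + u.2 ≤ L)
    (hv : v.1 + v.2 ≤ L) (h1 : L * c.1 + u.1 = L * c'.1 + v.1)
    (h2 : L * c.2 + u.2 = L * c'.2 + v.2) :
    u = if c.1 < c'.1 then (L, 0) else if c.2 < c'.2 then (0, L) else (0, 0) := by
  have key : ∀ {a a' : ℕ}, a < a' → L * a + L ≤ L * a' := fun h => by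
    simpa [Nat.mul_succ] using Nat.mul_le_mul_left L (Nat.succ_le_of_lt h)
  ext
  all_goals
    rcases lt_trichotomy c.1 c'.1 with h | h | h
    · have := key h
      simp only [h, if_true]
      rcases lt_trichotomy c.2 c'.2 with h' | h' | h'
      · have := key h'; omega
      · rw [h'] at h2; omega
      · have := key h'; omega
    · rcases lt_trichotomy c.2 c'.2 with h' | h' | h'
      · have := key h'
        simp only [h, h', lt_irrefl, if_true, if_false]
        rw [h] at h1
        omega
      · exact absurd (Prod.ext h h') hc
      · have := key h'
        simp only [h, h'.not_gt, lt_irrefl, if_false]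
        rw [h] at h1
        omega
    · have := key h
      rcases lt_trichotomy c.2 c'.2 with h' | h' | h'
      · have := key h'
        simp only [h.not_gt, h', if_true, if_false]
        omega
      · simp only [h.not_gt, h', lt_irrefl, if_false]
        rw [h'] at h2
        omega
      · have := key h'
        simp only [h.not_gt, h'.not_gt, if_false]
        omega

theorem place_eq_place {b n : ℕ} [NeZero b] {c c' : ℕ × ℕ} (hc : c ≠ c') {u v : verts b n}
    (h : place b n c u = place b n c' v) :
    u = if c.1 < c'.1 then right b n else if c.2 < c'.2 then top b n else left b n := by
  rw [place_apply, place_apply, Prod.mk.injEq] at h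
  have := eq_of_place_eq hc (add_le_of_mem_verts u.2) (add_le_of_mem_verts v.2) h.1 h.2
  apply Subtype.ext
  rw [this]
  split_ifs <;> rfl

/-- A copy of the gasket in the next one. -/
def placeVerts (b n : ℕ) (c : ℕ × ℕ) (hc : c ∈ cells b) : verts b n ↪ verts b (n + 1) where
  toFun v := ⟨place b n c v, place_mem hc v.2⟩
  inj' _ _ h := Subtype.ext ((place b n c).injective (congrArg Subtype.val h))

/-- The positions of the cells in `gasketCells`. -/
def cellPos : Fin gasketCells.length → ℕ × ℕ :=
  ![(0, 3), (0, 2), (1, 2), (0, 1), (1, 1), (2, 1), (0, 0), (1, 0), (2, 0), (3, 0)]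

/-- The positions of the vertices of the cells in `gasketCells`. -/
def vertexPos (x : ℕ) : ℕ × ℕ :=
  [(0, 3), (1, 3), (0, 2), (1, 2), (2, 2), (0, 1), (1, 0), (1, 1), (2, 0), (2, 1), (3, 0), (3, 1),
    (0, 0), (4, 0), (0, 4)].getD x (0, 0)

theorem cellPos_mem (c : Fin gasketCells.length) : cellPos c ∈ cells 4 := by
  revert c; decide

theorem cellPos_injective : Function.Injective cellPos := by decide

theorem exists_cellPos : ∀ c ∈ cells 4, ∃ i, cellPos i = c := by decide

theorem gasketCells_bound : ∀ c i, (gasketCells.get c).1 i < 15 := by decide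

theorem vertexPos_gasketCells : ∀ c i, vertexPos ((gasketCells.get c).1 i) =
    ((cellPos c).1 + ![0, 1, 0] i, (cellPos c).2 + ![0, 0, 1] i) := by decide

theorem exists_gasketCells : ∀ x < 15, ∃ c i, (gasketCells.get c).1 i = x := by decide

theorem vertexPos_injective : ∀ x < 15, ∀ y < 15, vertexPos x = vertexPos y → x = y := by decide

theorem place_outmost (n : ℕ) (c : Fin gasketCells.length) (i : Fin 3) :
    place 4 n (cellPos c) (outmost 4 n i) = (4 ^ n * (vertexPos ((gasketCells.get c).1 i)).1,
      4 ^ n * (vertexPos ((gasketCells.get c).1 i)).2) := by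
  rw [vertexPos_gasketCells, place_apply]
  fin_cases i <;> simp [outmost, left, right, top, mul_add]

theorem vertexPos_mem (n : ℕ) {x : ℕ} (hx : x < 15) :
    (4 ^ n * (vertexPos x).1, 4 ^ n * (vertexPos x).2) ∈ verts 4 (n + 1) := by
  obtain ⟨c, i, rfl⟩ := exists_gasketCells x hx
  rw [← place_outmost]
  exact place_mem (cellPos_mem c) (outmost 4 n i).2

theorem mem_range_outmost {n : ℕ} {c c' : Fin gasketCells.length} (hc : c ≠ c') {u v : verts 4 n}
    (h : place 4 n (cellPos c) u = place 4 n (cellPos c') v) : ∃ i, u = outmost 4 n i := by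
  rw [place_eq_place (cellPos_injective.ne hc) h]
  split_ifs
  exacts [⟨1, rfl⟩, ⟨2, rfl⟩, ⟨0, rfl⟩]

/-- The next gasket as ten copies of a gasket glued together. -/
def gasketGluing (n : ℕ) :
    Gluing (V := verts 4 n) (W := verts 4 (n + 1)) gasketCells (outmost 4 n) where
  φ c := placeVerts 4 n (cellPos c) (cellPos_mem c)
  p x := if hx : x < 15 then ⟨_, vertexPos_mem n hx⟩ else left 4 (n + 1)
  cover := by
    rintro ⟨x, hx⟩
    obtain ⟨c, hc, hx⟩ := Finset.mem_biUnion.1 hx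
    obtain ⟨v, hv, rfl⟩ := Finset.mem_map.1 hx
    obtain ⟨i, rfl⟩ := exists_cellPos c hc
    exact ⟨i, ⟨v, hv⟩, rfl⟩
  eq_of_lt x hx y hy h := by
    rw [dif_pos hx, dif_pos hy, Subtype.mk.injEq, Prod.mk.injEq] at h
    have h4 : 0 < 4 ^ n := by positivity
    exact vertexPos_injective x hx y hy
      (Prod.ext (Nat.eq_of_mul_eq_mul_left h4 h.1) (Nat.eq_of_mul_eq_mul_left h4 h.2))
  corner c i := by
    rw [dif_pos (gasketCells_bound c i)]
    exact Subtype.ext (place_outmost n c i)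
  bound := gasketCells_bound
  exists_cell := exists_gasketCells
  shared c c' hc u v h := mem_range_outmost hc (congrArg Subtype.val h)
  shared_unique c c' hc u u' v v' h h' := by
    rw [place_eq_place (cellPos_injective.ne hc) (congrArg Subtype.val h),
      place_eq_place (cellPos_injective.ne hc) (congrArg Subtype.val h')]

theorem glue_SG (n : ℕ) : (gasketGluing n).glue (fun _ => SG 4 n) = SG 4 (n + 1) := by
  ext x y
  rw [Gluing.glue_adj]
  simp only [SG, SimpleGraph.comap_adj, latticeGraph, SimpleGraph.iSup_adj, SimpleGraph.map_adj]
  constructor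
  · rintro ⟨c, u, v, h, rfl, rfl⟩
    exact ⟨cellPos c, cellPos_mem c, u, v, h, rfl, rfl⟩
  · rintro ⟨c, hc, u, v, h, hu, hv⟩
    obtain ⟨i, rfl⟩ := exists_cellPos c hc
    obtain ⟨h1, h2⟩ := mem_verts_of_adj h
    exact ⟨i, ⟨u, h1⟩, ⟨v, h2⟩, h, Subtype.ext hu, Subtype.ext hv⟩

theorem outer_gasketGluing (n : ℕ) : (gasketGluing n).outer = outmost 4 (n + 1) := by
  ext1 i
  apply Subtype.ext
  fin_cases i <;>
    simp [Gluing.outer, gasketGluing, outmost, left, right, top, vertexPos, pow_succ]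

theorem stateCount_succ (n : ℕ) (t : CellState) :
    stateCount (SG 4 (n + 1)) (outmost 4 (n + 1)) t =
      treeSum (stateCount (SG 4 n) (outmost 4 n)) t gasketCells id := by
  rw [← outer_gasketGluing, ← glue_SG]
  exact (gasketGluing n).stateCount_glue _ t

theorem stateCount_eq_weight (n : ℕ) :
    stateCount (SG 4 n) (outmost 4 n) = weight (f 4 n) (g 4 n) (h 4 n) := by
  have key : ∃ x y z, stateCount (SG 4 n) (outmost 4 n) = weight x y z := by
    induction n with
    | zero => exact ⟨4, 1, 1, funext (stateCount_zero 4)⟩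
    | succ n ih =>
      obtain ⟨x, y, z, ih⟩ := ih
      refine ⟨treeSum (weight x y z) all gasketCells id,
        treeSum (weight x y z) (solo 2) gasketCells id,
        treeSum (weight x y z) apart gasketCells id, funext fun s => ?_⟩
      rw [stateCount_succ, ih]
      rcases s with _ | i | _
      · rfl
      · rw [weight, treeSum_solo, treeSum_solo]
      · rfl
  obtain ⟨x, y, z, h⟩ := key
  rw [f_eq, g_eq, h_eq, h]
  rfl

theorem f_succ (n : ℕ) :
    f 4 (n + 1) = treeSum (weight (f 4 n) (g 4 n) (h 4 n)) all gasketCells id := by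
  rw [f_eq 4 (n + 1), stateCount_succ, stateCount_eq_weight]

theorem g_succ (n : ℕ) :
    g 4 (n + 1) = treeSum (weight (f 4 n) (g 4 n) (h 4 n)) (solo 2) gasketCells id := by
  rw [g_eq 4 (n + 1), stateCount_succ, stateCount_eq_weight]

theorem h_succ (n : ℕ) :
    h 4 (n + 1) = treeSum (weight (f 4 n) (g 4 n) (h 4 n)) apart gasketCells id := by
  rw [h_eq 4 (n + 1), stateCount_succ, stateCount_eq_weight]

theorem f_zero : f 4 0 = 4 := by rw [f_eq, stateCount_zero]; rfl

theorem g_zero : g 4 0 = 1 := by rw [g_eq, stateCount_zero]; rfl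

theorem h_zero : h 4 0 = 1 := by rw [h_eq, stateCount_zero]; rfl

/-! ### The number of vertices -/

theorem card_verts_succ (n : ℕ) : (verts 4 (n + 1)).card + 15 = 10 * (verts 4 n).card := by
  classical
  set Γ := gasketGluing n
  set S : Finset (verts 4 n) := Finset.univ.image (outmost 4 n) with hS
  have hScard : S.card = 3 := by
    rw [hS, Finset.card_image_of_injective _ (outmost_injective 4 n), Finset.card_univ,
      Fintype.card_fin]
  set A : Finset (verts 4 (n + 1)) := Finset.univ.biUnion fun c => Sᶜ.map (Γ.φ c) with hA
  set B : Finset (verts 4 (n + 1)) := (Finset.range 15).image Γ.p with hB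
  have hAcard : A.card = 10 * ((verts 4 n).card - 3) := by
    rw [hA, Finset.card_biUnion]
    · simp only [Finset.card_map, Finset.card_compl, hScard, Fintype.card_coe, Finset.sum_const,
        Finset.card_univ, Fintype.card_fin, smul_eq_mul]
      rfl
    · intro c _ c' _ hc
      refine Finset.disjoint_left.2 fun x hx hx' => ?_
      obtain ⟨u, hu, rfl⟩ := Finset.mem_map.1 hx
      obtain ⟨v, -, hv⟩ := Finset.mem_map.1 hx'
      obtain ⟨i, rfl⟩ := Γ.shared c c' hc _ _ hv.symm
      simp [hS] at hu
  have hBcard : B.card = 15 := by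
    rw [hB, Finset.card_image_of_injOn, Finset.card_range]
    intro x hx y hy h
    exact Γ.eq_of_lt x (by simpa using hx) y (by simpa using hy) h
  have hAB : Disjoint A B := by
    refine Finset.disjoint_left.2 fun x hx hx' => ?_
    obtain ⟨c, -, hx⟩ := Finset.mem_biUnion.1 hx
    obtain ⟨u, hu, rfl⟩ := Finset.mem_map.1 hx
    obtain ⟨y, hy, hy'⟩ := Finset.mem_image.1 hx'
    obtain ⟨c', i, rfl⟩ := Γ.exists_cell y (by simpa using hy)
    rw [← Γ.corner] at hy'
    have : ∃ j, u = outmost 4 n j := by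
      by_cases hc : c = c'
      · subst hc
        exact ⟨i, (Γ.φ c).injective hy'.symm⟩
      · exact Γ.shared c c' hc _ _ hy'.symm
    obtain ⟨j, rfl⟩ := this
    simp [hS] at hu
  have hAB' : A ∪ B = Finset.univ := by
    refine Finset.eq_univ_of_forall fun x => ?_
    obtain ⟨c, u, rfl⟩ := Γ.cover x
    by_cases hu : u ∈ S
    · obtain ⟨i, -, rfl⟩ := Finset.mem_image.1 hu
      rw [Γ.corner]
      exact Finset.mem_union_right _ (Finset.mem_image_of_mem _ (by simpa using Γ.bound c i))
    · exact Finset.mem_union_left _ (Finset.mem_biUnion.2 ⟨c, Finset.mem_univ _,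
        Finset.mem_map_of_mem _ (Finset.mem_compl.2 hu)⟩)
  have h1 := Finset.card_union_of_disjoint hAB
  have h2 : 3 ≤ (verts 4 n).card := by
    rw [← hScard, ← Fintype.card_coe (verts 4 n)]
    exact Finset.card_le_univ S
  rw [hAB', hAcard, hBcard, Finset.card_univ, Fintype.card_coe] at h1
  omega

theorem card_verts (n : ℕ) : 3 * (verts 4 n).card = 4 * 10 ^ n + 5 := by
  induction n with
  | zero => rfl
  | succ n ih =>
    have := card_verts_succ n
    rw [pow_succ]
    omega

/-! ### Polynomial inequalities -/

/-- `P24` as a polynomial in `α` and `α / β`. -/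
def polyP (a c : ℝ) : ℝ :=
  11354 + 5856 * c + 516 * c ^ 2 + 2 * c ^ 3 + 13626 * a + 4140 * a * c + 174 * a * c ^ 2
    + 6936 * a ^ 2 + 1140 * a ^ 2 * c + 15 * a ^ 2 * c ^ 2 + 1928 * a ^ 3 + 144 * a ^ 3 * c
    + 309 * a ^ 4 + 7 * a ^ 4 * c + 27 * a ^ 5 + a ^ 6

/-- `Q24` as a polynomial in `α` and `α / β`. -/
def polyQ (a c : ℝ) : ℝ :=
  13732 + 14480 * c + 2786 * c ^ 2 + 82 * c ^ 3 + 16250 * a + 10609 * a * c + 1095 * a * c ^ 2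
    + 12 * a * c ^ 3 + 8015 * a ^ 2 + 3130 * a ^ 2 * c + 142 * a ^ 2 * c ^ 2 + 2148 * a ^ 3
    + 462 * a ^ 3 * c + 6 * a ^ 3 * c ^ 2 + 332 * a ^ 4 + 34 * a ^ 4 * c + 28 * a ^ 5 + a ^ 5 * c
    + a ^ 6

/-- The analogue of `polyP` and `polyQ` for the recursion of `h`. -/
def polyR (a c : ℝ) : ℝ :=
  42210 + 83234 * c + 30948 * c ^ 2 + 2388 * c ^ 3 + 20 * c ^ 4 + 53826 * a + 61422 * a * c
    + 12756 * a * c ^ 2 + 444 * a * c ^ 3 + 26934 * a ^ 2 + 17763 * a ^ 2 * c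
    + 1869 * a ^ 2 * c ^ 2 + 15 * a ^ 2 * c ^ 3 + 7113 * a ^ 3 + 2558 * a ^ 3 * c
    + 117 * a ^ 3 * c ^ 2 + 1068 * a ^ 4 + 189 * a ^ 4 * c + 3 * a ^ 4 * c ^ 2 + 87 * a ^ 5
    + 6 * a ^ 5 * c + 3 * a ^ 6

theorem polyP_mono {a a' c c' : ℝ} (ha : 0 ≤ a) (haa : a ≤ a') (hc : 0 ≤ c) (hcc : c ≤ c') :
    polyP a c ≤ polyP a' c' := by
  have := ha.trans haa
  unfold polyP
  gcongr

theorem polyQ_mono {a a' c c' : ℝ} (ha : 0 ≤ a) (haa : a ≤ a') (hc : 0 ≤ c) (hcc : c ≤ c') :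
    polyQ a c ≤ polyQ a' c' := by
  have := ha.trans haa
  unfold polyQ
  gcongr

theorem polyP_pos {a c : ℝ} (ha : 0 ≤ a) (hc : 0 ≤ c) : 0 < polyP a c := by
  unfold polyP; positivity

theorem polyQ_pos {a c : ℝ} (ha : 0 ≤ a) (hc : 0 ≤ c) : 0 < polyQ a c := by
  unfold polyQ; positivity

theorem polyP_le_polyQ {a c : ℝ} (ha : 0 ≤ a) (hc : 0 ≤ c) : polyP a c ≤ polyQ a c := by
  rw [← sub_nonneg]
  have : polyQ a c - polyP a c =
      2378 + 8624 * c + 2270 * c ^ 2 + 80 * c ^ 3 + 2624 * a + 6469 * a * c + 921 * a * c ^ 2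
        + 12 * a * c ^ 3 + 1079 * a ^ 2 + 1990 * a ^ 2 * c + 127 * a ^ 2 * c ^ 2 + 220 * a ^ 3
        + 318 * a ^ 3 * c + 6 * a ^ 3 * c ^ 2 + 23 * a ^ 4 + 27 * a ^ 4 * c + a ^ 5 + a ^ 5 * c := by
    unfold polyP polyQ; ring
  rw [this]
  positivity

theorem polyQ_le_ten_mul_polyP {a c : ℝ} (ha : 0 ≤ a) (hc : 0 ≤ c) (hc' : c ≤ 4) :
    polyQ a c ≤ 10 * polyP a c := by
  obtain ⟨d, rfl⟩ : ∃ d, c = 4 - d := ⟨4 - c, by ring⟩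
  have hd : 0 ≤ d := by linarith
  have h1 : 0 ≤ 4 - d := hc
  have h2 : (4 - d) ^ 2 ≤ 16 := by nlinarith
  have h3 : (4 - d) ^ 3 ≤ 64 := by nlinarith
  unfold polyP polyQ
  generalize 4 - d = c at *
  have e1 : a * c ^ 3 ≤ a * 64 := by gcongr
  have e2 : a ^ 3 * c ^ 2 ≤ a ^ 3 * 16 := by gcongr
  have e3 : a ^ 5 * c ≤ a ^ 5 * 4 := by gcongr
  have : 0 ≤ a * c := by positivity
  have : 0 ≤ a * c ^ 2 := by positivity
  have : 0 ≤ a ^ 2 * c := by positivity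
  have : 0 ≤ a ^ 2 * c ^ 2 := by positivity
  have : 0 ≤ a ^ 3 * c := by positivity
  have : 0 ≤ a ^ 4 * c := by positivity
  have : 0 ≤ a ^ 2 := by positivity
  have : 0 ≤ a ^ 3 := by positivity
  have : 0 ≤ a ^ 4 := by positivity
  have : 0 ≤ a ^ 5 := by positivity
  have : 0 ≤ a ^ 6 := by positivity
  have : 0 ≤ c ^ 2 := by positivity
  linarith

theorem three_mul_sq_add_le {a c : ℝ} (ha : 0 ≤ a) (ha' : a ≤ 17 / 8) (hc : 3 ≤ c)
    (hc' : c ≤ 31 / 10) :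
    3 * polyQ a c ^ 2 + a / 20 * (polyP a c * polyQ a c) ≤ polyP a c * polyR a c := by
  obtain ⟨t, rfl⟩ : ∃ t, c = 3 + t := ⟨c - 3, by ring⟩
  have ht : 0 ≤ t := by linarith
  have ht' : t ≤ 1 / 10 := by linarith
  have hpow : ∀ i : ℕ, 0 ≤ t ^ (i + 1) ∧ t ^ (i + 1) ≤ t := fun i =>
    ⟨by positivity, by simpa using pow_le_pow_of_le_one ht (by linarith) (Nat.le_add_left 1 i)⟩
  obtain ⟨t2, u2⟩ : 0 ≤ t ^ 2 ∧ t ^ 2 ≤ t := hpow 1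
  obtain ⟨t3, u3⟩ : 0 ≤ t ^ 3 ∧ t ^ 3 ≤ t := hpow 2
  obtain ⟨t4, u4⟩ : 0 ≤ t ^ 4 ∧ t ^ 4 ≤ t := hpow 3
  obtain ⟨t5, u5⟩ : 0 ≤ t ^ 5 ∧ t ^ 5 ≤ t := hpow 4
  obtain ⟨t6, u6⟩ : 0 ≤ t ^ 6 ∧ t ^ 6 ≤ t := hpow 5
  obtain ⟨t7, u7⟩ : 0 ≤ t ^ 7 ∧ t ^ 7 ≤ t := hpow 6
  have e0 : a ^ 0 * (0) ≤ a ^ 0 * (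
      83287600 * t + 26783568 * t ^ 2 + 2840172 * t ^ 3 - 102484 * t ^ 4 - 43296 * t ^ 5
        - 4236 * t ^ 6 + 40 * t ^ 7) :=
    mul_le_mul_of_nonneg_left (by linarith) (by positivity)
  have e1 : a ^ 1 * (179754740) ≤ a ^ 1 * (
      179754740 + 250568092 * t + 63276871 * t ^ 2 + 31953779 / 5 * t ^ 3 + 724058 / 5 * t ^ 4
        - 82969 / 5 * t ^ 5 - 7721 / 5 * t ^ 6) :=
    mul_le_mul_of_nonneg_left (by linarith) (by positivity)
  have e2 : a ^ 2 * (165738028) ≤ a ^ 2 * (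
      165738028 + 979425571 / 5 * t + 81308775 / 2 * t ^ 2 + 16635212 / 5 * t ^ 3
        + 354859 / 5 * t ^ 4 - 43401 / 10 * t ^ 5 - 516 / 5 * t ^ 6) :=
    mul_le_mul_of_nonneg_left (by linarith) (by positivity)
  have e3 : a ^ 3 * (243806072 / 5) ≤ a ^ 3 * (
      243806072 / 5 + 357928403 / 5 * t + 24064957 / 2 * t ^ 2 + 3637781 / 5 * t ^ 3
        + 94939 / 10 * t ^ 4 - 9721 / 10 * t ^ 5) :=
    mul_le_mul_of_nonneg_left (by linarith) (by positivity)
  have e4 : a ^ 4 * (-6809699) ≤ a ^ 4 * (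
      -34048493 / 5 + 243738803 / 20 * t + 32008683 / 20 * t ^ 2 + 1106257 / 20 * t ^ 3
        - 4881 / 20 * t ^ 4 - 353 / 5 * t ^ 5) :=
    mul_le_mul_of_nonneg_left (by linarith) (by positivity)
  have e5 : a ^ 5 * (-10222146) ≤ a ^ 5 * (
      -203805929 / 20 - 1362812 / 5 * t - 161113 / 4 * t ^ 2 - 10833 / 2 * t ^ 3
        - 1161 / 5 * t ^ 4) :=
    mul_le_mul_of_nonneg_left (by linarith) (by positivity)
  have e6 : a ^ 6 * (-4030771) ≤ a ^ 6 * (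
      -19811079 / 5 - 3164178 / 5 * t - 205281 / 4 * t ^ 2 - 5485 / 4 * t ^ 3 - 94 / 5 * t ^ 4) :=
    mul_le_mul_of_nonneg_left (by linarith) (by positivity)
  have e7 : a ^ 7 * (-941125) ≤ a ^ 7 * (
      -4622322 / 5 - 157607 * t - 177713 / 20 * t ^ 2 - 211 / 2 * t ^ 3) :=
    mul_le_mul_of_nonneg_left (by linarith) (by positivity)
  have e8 : a ^ 8 * (-150123) ≤ a ^ 8 * (
      -295725 / 2 - 218187 / 10 * t - 3882 / 5 * t ^ 2 - 69 / 20 * t ^ 3) :=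
    mul_le_mul_of_nonneg_left (by linarith) (by positivity)
  have e9 : a ^ 9 * (-17124) ≤ a ^ 9 * (
      -33859 / 2 - 1907 * t - 701 / 20 * t ^ 2) :=
    mul_le_mul_of_nonneg_left (by linarith) (by positivity)
  have e10 : a ^ 10 * (-1406) ≤ a ^ 10 * (
      -6974 / 5 - 2107 / 20 * t - 13 / 20 * t ^ 2) :=
    mul_le_mul_of_nonneg_left (by linarith) (by positivity)
  have e11 : a ^ 11 * (-81) ≤ a ^ 11 * (
      -1601 / 20 - 17 / 5 * t) :=
    mul_le_mul_of_nonneg_left (by linarith) (by positivity)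
  have e12 : a ^ 12 * (-3) ≤ a ^ 12 * (
      -29 / 10 - 1 / 20 * t) :=
    mul_le_mul_of_nonneg_left (by linarith) (by positivity)
  have e13 : a ^ 13 * (-1) ≤ a ^ 13 * (
      -1 / 20) :=
    mul_le_mul_of_nonneg_left (by linarith) (by positivity)
  have hstep : ∀ i : ℕ, a ^ (i + 1) ≤ a ^ i * (17 / 8) := fun i => by
    rw [pow_succ]; gcongr
  have s1 : a ^ 2 ≤ a ^ 1 * (17 / 8) := hstep 1
  have s2 : a ^ 3 ≤ a ^ 2 * (17 / 8) := hstep 2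
  have s3 : a ^ 4 ≤ a ^ 3 * (17 / 8) := hstep 3
  have s4 : a ^ 5 ≤ a ^ 4 * (17 / 8) := hstep 4
  have s5 : a ^ 6 ≤ a ^ 5 * (17 / 8) := hstep 5
  have s6 : a ^ 7 ≤ a ^ 6 * (17 / 8) := hstep 6
  have s7 : a ^ 8 ≤ a ^ 7 * (17 / 8) := hstep 7
  have s8 : a ^ 9 ≤ a ^ 8 * (17 / 8) := hstep 8
  have s9 : a ^ 10 ≤ a ^ 9 * (17 / 8) := hstep 9
  have s10 : a ^ 11 ≤ a ^ 10 * (17 / 8) := hstep 10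
  have s11 : a ^ 12 ≤ a ^ 11 * (17 / 8) := hstep 11
  have s12 : a ^ 13 ≤ a ^ 12 * (17 / 8) := hstep 12
  have p0 : 0 ≤ a ^ 0 := by positivity
  have p1 : 0 ≤ a ^ 1 := by positivity
  have p2 : 0 ≤ a ^ 2 := by positivity
  have p3 : 0 ≤ a ^ 3 := by positivity
  have p4 : 0 ≤ a ^ 4 := by positivity
  have key : polyP a (3 + t) * polyR a (3 + t) - (3 * polyQ a (3 + t) ^ 2 +
      a / 20 * (polyP a (3 + t) * polyQ a (3 + t))) =
      a ^ 0 * (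
        83287600 * t + 26783568 * t ^ 2 + 2840172 * t ^ 3 - 102484 * t ^ 4 - 43296 * t ^ 5
          - 4236 * t ^ 6 + 40 * t ^ 7) + a ^ 1 * (
        179754740 + 250568092 * t + 63276871 * t ^ 2 + 31953779 / 5 * t ^ 3 + 724058 / 5 * t ^ 4
          - 82969 / 5 * t ^ 5 - 7721 / 5 * t ^ 6) + a ^ 2 * (
        165738028 + 979425571 / 5 * t + 81308775 / 2 * t ^ 2 + 16635212 / 5 * t ^ 3
          + 354859 / 5 * t ^ 4 - 43401 / 10 * t ^ 5 - 516 / 5 * t ^ 6) + a ^ 3 * (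
        243806072 / 5 + 357928403 / 5 * t + 24064957 / 2 * t ^ 2 + 3637781 / 5 * t ^ 3
          + 94939 / 10 * t ^ 4 - 9721 / 10 * t ^ 5) + a ^ 4 * (
        -34048493 / 5 + 243738803 / 20 * t + 32008683 / 20 * t ^ 2 + 1106257 / 20 * t ^ 3
          - 4881 / 20 * t ^ 4 - 353 / 5 * t ^ 5) + a ^ 5 * (
        -203805929 / 20 - 1362812 / 5 * t - 161113 / 4 * t ^ 2 - 10833 / 2 * t ^ 3
          - 1161 / 5 * t ^ 4) + a ^ 6 * (
        -19811079 / 5 - 3164178 / 5 * t - 205281 / 4 * t ^ 2 - 5485 / 4 * t ^ 3 - 94 / 5 * t ^ 4) + a ^ 7 * (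
        -4622322 / 5 - 157607 * t - 177713 / 20 * t ^ 2 - 211 / 2 * t ^ 3) + a ^ 8 * (
        -295725 / 2 - 218187 / 10 * t - 3882 / 5 * t ^ 2 - 69 / 20 * t ^ 3) + a ^ 9 * (
        -33859 / 2 - 1907 * t - 701 / 20 * t ^ 2) + a ^ 10 * (
        -6974 / 5 - 2107 / 20 * t - 13 / 20 * t ^ 2) + a ^ 11 * (
        -1601 / 20 - 17 / 5 * t) + a ^ 12 * (
        -29 / 10 - 1 / 20 * t) + a ^ 13 * (
        -1 / 20) := by
    unfold polyP polyQ polyR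
    ring
  rw [← sub_nonneg, key]
  linarith

theorem polyP_mul_polyR_le {a c : ℝ} (ha : 0 ≤ a) (hc : a / 20 ≤ c - 3) :
    polyP a c * polyR a c ≤ c * polyQ a c ^ 2 := by
  obtain ⟨s, rfl⟩ : ∃ s, c = 3 + a / 20 + s := ⟨c - 3 - a / 20, by ring⟩
  have hs : 0 ≤ s := by linarith
  rw [← sub_nonneg]
  unfold polyP polyQ polyR
  ring_nf
  positivity

/-! ### The quotients of the counts -/

theorem counts_pos (n : ℕ) : 0 < f 4 n ∧ 0 < g 4 n ∧ 0 < h 4 n := by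
  induction n with
  | zero => simp [f_zero, g_zero, h_zero]
  | succ n ih =>
    obtain ⟨h1, h2, h3⟩ := ih
    rw [f_succ, g_succ, h_succ, treeSum_all, treeSum_solo, treeSum_apart]
    exact ⟨by positivity, by positivity, by positivity⟩

/-- The quotient of `α` and `β`. -/
noncomputable def quot (n : ℕ) : ℝ := α 4 n / β 4 n

theorem f_pos (n : ℕ) : (0 : ℝ) < f 4 n := Nat.cast_pos.2 (counts_pos n).1

theorem g_pos (n : ℕ) : (0 : ℝ) < g 4 n := Nat.cast_pos.2 (counts_pos n).2.1

theorem h_pos (n : ℕ) : (0 : ℝ) < h 4 n := Nat.cast_pos.2 (counts_pos n).2.2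

theorem α_pos (n : ℕ) : 0 < α 4 n := div_pos (f_pos n) (g_pos n)

theorem β_pos (n : ℕ) : 0 < β 4 n := div_pos (g_pos n) (h_pos n)

theorem quot_pos (n : ℕ) : 0 < quot n := div_pos (α_pos n) (β_pos n)

theorem quot_eq (n : ℕ) : quot n = (f 4 n : ℝ) * h 4 n / (g 4 n : ℝ) ^ 2 := by
  have := g_pos n
  have := h_pos n
  rw [quot, α, β]
  field_simp

theorem P24_eq (n : ℕ) : P24 n = polyP (α 4 n) (quot n) := by
  have := (β_pos n).ne'
  rw [P24, polyP, quot]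
  field_simp

theorem Q24_eq (n : ℕ) : Q24 n = polyQ (α 4 n) (quot n) := by
  have := (β_pos n).ne'
  rw [Q24, polyQ, quot]
  field_simp

theorem f_succ_eq (n : ℕ) :
    (f 4 (n + 1) : ℝ) = (f 4 n : ℝ) ^ 4 * (g 4 n : ℝ) ^ 6 * polyP (α 4 n) (quot n) := by
  have := (g_pos n).ne'
  have := (f_pos n).ne'
  rw [f_succ, treeSum_all, quot_eq, α, polyP]
  push_cast
  field_simp
  ring

theorem g_succ_eq (n : ℕ) :
    (g 4 (n + 1) : ℝ) = (f 4 n : ℝ) ^ 3 * (g 4 n : ℝ) ^ 7 * polyQ (α 4 n) (quot n) := by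
  have := (g_pos n).ne'
  have := (f_pos n).ne'
  rw [g_succ, treeSum_solo, quot_eq, α, polyQ]
  push_cast
  field_simp
  ring

theorem h_succ_eq (n : ℕ) :
    (h 4 (n + 1) : ℝ) = (f 4 n : ℝ) ^ 2 * (g 4 n : ℝ) ^ 8 * polyR (α 4 n) (quot n) := by
  have := (g_pos n).ne'
  have := (f_pos n).ne'
  rw [h_succ, treeSum_apart, quot_eq, α, polyR]
  push_cast
  field_simp
  ring

theorem α_succ (n : ℕ) :
    α 4 (n + 1) = α 4 n * polyP (α 4 n) (quot n) / polyQ (α 4 n) (quot n) := by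
  have h1 := (g_pos n).ne'
  have h2 := (f_pos n).ne'
  have h3 := (polyQ_pos (α_pos n).le (quot_pos n).le).ne'
  have h4 : α 4 n = (f 4 n : ℝ) / g 4 n := rfl
  rw [α, f_succ_eq, g_succ_eq]
  generalize polyP (α 4 n) (quot n) = p at *
  generalize polyQ (α 4 n) (quot n) = q at *
  rw [h4]
  field_simp

theorem quot_succ (n : ℕ) : quot (n + 1) =
    polyP (α 4 n) (quot n) * polyR (α 4 n) (quot n) / polyQ (α 4 n) (quot n) ^ 2 := by
  have h1 := (g_pos n).ne'
  have h2 := (f_pos n).ne'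
  have h3 := (polyQ_pos (α_pos n).le (quot_pos n).le).ne'
  rw [quot_eq (n + 1), f_succ_eq, g_succ_eq, h_succ_eq]
  generalize polyP (α 4 n) (quot n) = p at *
  generalize polyQ (α 4 n) (quot n) = q at *
  generalize polyR (α 4 n) (quot n) = r at *
  field_simp

theorem α_zero : α 4 0 = 4 := by simp [α, f_zero, g_zero]

theorem quot_zero : quot 0 = 4 := by simp [quot_eq, f_zero, g_zero, h_zero]

theorem α_one : α 4 1 = 4 * polyP 4 4 / polyQ 4 4 := by
  rw [α_succ 0, α_zero, quot_zero]

theorem quot_one : quot 1 = polyP 4 4 * polyR 4 4 / polyQ 4 4 ^ 2 := by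
  rw [quot_succ 0, α_zero, quot_zero]

theorem α_succ_le (n : ℕ) : α 4 (n + 1) ≤ α 4 n := by
  rw [α_succ, div_le_iff₀ (polyQ_pos (α_pos n).le (quot_pos n).le)]
  exact mul_le_mul_of_nonneg_left (polyP_le_polyQ (α_pos n).le (quot_pos n).le) (α_pos n).le

theorem α_antitone : Antitone fun n => α 4 n := antitone_nat_of_succ_le α_succ_le

theorem quot_succ_bound {n : ℕ} (ha : α 4 n ≤ 17 / 8) (hc : 3 ≤ quot n)
    (hc' : quot n ≤ 31 / 10) : α 4 (n + 1) / 20 ≤ quot (n + 1) - 3 := by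
  have hq := polyQ_pos (α_pos n).le (quot_pos n).le
  have key := three_mul_sq_add_le (α_pos n).le ha hc hc'
  rw [α_succ, quot_succ, ← sub_nonneg]
  have : polyP (α 4 n) (quot n) * polyR (α 4 n) (quot n) / polyQ (α 4 n) (quot n) ^ 2 - 3 -
      α 4 n * polyP (α 4 n) (quot n) / polyQ (α 4 n) (quot n) / 20 =
      (polyP (α 4 n) (quot n) * polyR (α 4 n) (quot n) - (3 * polyQ (α 4 n) (quot n) ^ 2 +
        α 4 n / 20 * (polyP (α 4 n) (quot n) * polyQ (α 4 n) (quot n)))) /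
        polyQ (α 4 n) (quot n) ^ 2 := by
    field_simp
    ring
  rw [this]
  exact div_nonneg (sub_nonneg.2 key) (by positivity)

theorem quot_succ_le {n : ℕ} (hc : α 4 n / 20 ≤ quot n - 3) : quot (n + 1) ≤ quot n := by
  have hq := polyQ_pos (α_pos n).le (quot_pos n).le
  rw [quot_succ, div_le_iff₀ (by positivity)]
  exact polyP_mul_polyR_le (α_pos n).le hc

theorem α_one_le : α 4 1 ≤ 17 / 8 := by
  rw [α_one, polyP, polyQ]; norm_num

theorem quot_one_bounds : 3 ≤ quot 1 ∧ quot 1 ≤ 31 / 10 := by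
  rw [quot_one, polyP, polyQ, polyR]; norm_num

theorem quot_two_le : quot 2 ≤ quot 1 := by
  rw [quot_succ 1, α_one, quot_one]
  norm_num [polyP, polyQ, polyR]

theorem quot_bounds (n : ℕ) :
    3 ≤ quot (n + 1) ∧ quot (n + 1) ≤ 31 / 10 ∧ quot (n + 2) ≤ quot (n + 1) := by
  induction n with
  | zero => exact ⟨quot_one_bounds.1, quot_one_bounds.2, quot_two_le⟩
  | succ n ih =>
    obtain ⟨h1, h2, h3⟩ := ih
    have ha : α 4 (n + 1) ≤ 17 / 8 := (α_antitone (Nat.le_add_left 1 n)).trans α_one_le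
    have h4 := quot_succ_bound ha h1 h2
    have h5 := α_pos (n + 2)
    exact ⟨by linarith, h3.trans h2, quot_succ_le h4⟩

theorem three_le_quot (n : ℕ) : 3 ≤ quot n := by
  cases n with
  | zero => rw [quot_zero]; norm_num
  | succ n => exact (quot_bounds n).1

theorem quot_le_four (n : ℕ) : quot n ≤ 4 := by
  cases n with
  | zero => rw [quot_zero]
  | succ n => exact (quot_bounds n).2.1.trans (by norm_num)

theorem quot_le_quot {m n : ℕ} (hm : 0 < m) (hmn : m ≤ n) : quot n ≤ quot m := by
  induction n, hmn using Nat.le_induction with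
  | base => exact le_rfl
  | succ n hn ih =>
    obtain ⟨k, rfl⟩ := Nat.exists_eq_succ_of_ne_zero (hm.trans_le hn).ne'
    exact (quot_bounds k).2.2.trans ih

theorem abs_log_α_le (n : ℕ) : |Real.log (α 4 n)| ≤ (n + 1) * Real.log 10 := by
  have h10 : 0 < Real.log 10 := Real.log_pos (by norm_num)
  rw [abs_le]
  constructor
  · have key : (10 : ℝ) ^ (-(n : ℤ)) ≤ α 4 n := by
      induction n with
      | zero => rw [α_zero]; norm_num
      | succ n ih =>
        have hq := polyQ_pos (α_pos n).le (quot_pos n).le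
        have := polyQ_le_ten_mul_polyP (α_pos n).le (quot_pos n).le (quot_le_four n)
        have h1 : α 4 n / 10 ≤ α 4 (n + 1) := by
          rw [α_succ, div_le_div_iff₀ (by norm_num) hq]
          nlinarith [α_pos n]
        refine le_trans ?_ h1
        rw [Nat.cast_succ, neg_add, ← sub_eq_add_neg, zpow_sub_one₀ (by norm_num), ← div_eq_mul_inv]
        gcongr
    have := Real.log_le_log (by positivity) key
    rw [Real.log_zpow] at this
    push_cast at this
    linarith
  · have h1 : α 4 n ≤ 10 := (α_antitone n.zero_le).trans (α_zero.trans_le (by norm_num))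
    have h2 := Real.log_le_log (α_pos n) h1
    nlinarith [n.cast_nonneg (α := ℝ)]

/-! ### The asymptotic growth constant -/

/-- The increments in the recursion of `log f + 2 log g`. -/
noncomputable def logPQ (n : ℕ) : ℝ := Real.log (P24 n) + 2 * Real.log (Q24 n)

/-- The normalized logarithms of the counts. -/
noncomputable def logCount (n : ℕ) : ℝ :=
  (Real.log (f 4 n) + 2 * Real.log (g 4 n)) / 10 ^ n

theorem logCount_succ (n : ℕ) : logCount (n + 1) = logCount n + logPQ n / 10 ^ (n + 1) := by
  have h1 := (g_pos n).ne'
  have h2 := (f_pos n).ne'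
  have h3 := (polyP_pos (α_pos n).le (quot_pos n).le).ne'
  have h4 := (polyQ_pos (α_pos n).le (quot_pos n).le).ne'
  rw [logCount, logCount, logPQ, P24_eq, Q24_eq, f_succ_eq, g_succ_eq,
    Real.log_mul (by positivity) h3, Real.log_mul (by positivity) (by positivity),
    Real.log_mul (by positivity) h4, Real.log_mul (by positivity) (by positivity)]
  simp only [Real.log_pow]
  field_simp
  push_cast
  ring

theorem le_logPQ (n : ℕ) : Real.log 33620 + 2 * Real.log 84460 ≤ logPQ n := by
  rw [logPQ, P24_eq, Q24_eq]
  have h1 : (33620 : ℝ) = polyP 0 3 := by norm_num [polyP]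
  have h2 : (84460 : ℝ) = polyQ 0 3 := by norm_num [polyQ]
  have h3 := polyP_mono le_rfl (α_pos n).le (by norm_num) (three_le_quot n)
  have h4 := polyQ_mono le_rfl (α_pos n).le (by norm_num) (three_le_quot n)
  rw [← h1] at h3
  rw [← h2] at h4
  have h5 := Real.log_le_log (by norm_num) h3
  have h6 := Real.log_le_log (by norm_num) h4
  linarith

theorem logPQ_le {m n : ℕ} (hm : 0 < m) (hmn : m ≤ n) : logPQ n ≤ logPQ m := by
  rw [logPQ, logPQ, P24_eq, Q24_eq, P24_eq, Q24_eq]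
  have h1 := polyP_mono (α_pos n).le (α_antitone hmn) (quot_pos n).le (quot_le_quot hm hmn)
  have h2 := polyQ_mono (α_pos n).le (α_antitone hmn) (quot_pos n).le (quot_le_quot hm hmn)
  have h3 := Real.log_le_log (polyP_pos (α_pos n).le (quot_pos n).le) h1
  have h4 := Real.log_le_log (polyQ_pos (α_pos n).le (quot_pos n).le) h2
  linarith

theorem logPQ_pos (n : ℕ) : 0 < logPQ n :=
  (add_pos (Real.log_pos (by norm_num)) (mul_pos two_pos (Real.log_pos (by norm_num)))).trans_le
    (le_logPQ n)

theorem logCount_monotone : Monotone logCount := monotone_nat_of_le_succ fun n => by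
  rw [logCount_succ]
  have := logPQ_pos n
  have : 0 ≤ logPQ n / 10 ^ (n + 1) := by positivity
  linarith

theorem logCount_upper {m n : ℕ} (hm : 0 < m) (hmn : m ≤ n) :
    logCount n + logPQ m / (9 * 10 ^ n) ≤ logCount m + logPQ m / (9 * 10 ^ m) := by
  induction n, hmn using Nat.le_induction with
  | base => exact le_rfl
  | succ n hn ih =>
    refine le_trans ?_ ih
    have h1 : logPQ n / 10 ^ (n + 1) ≤ logPQ m / 10 ^ (n + 1) := by
      have := logPQ_le hm hn
      gcongr
    have h2 : logPQ m / (9 * 10 ^ n) =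
        logPQ m / 10 ^ (n + 1) + logPQ m / (9 * 10 ^ (n + 1)) := by
      field_simp
      ring
    rw [logCount_succ]
    linarith

theorem logCount_lower {m n : ℕ} (hmn : m ≤ n) {c : ℝ} (hc : ∀ n, c ≤ logPQ n) :
    logCount m + c / (9 * 10 ^ m) ≤ logCount n + c / (9 * 10 ^ n) := by
  induction n, hmn using Nat.le_induction with
  | base => exact le_rfl
  | succ n hn ih =>
    refine ih.trans ?_
    have h1 : c / 10 ^ (n + 1) ≤ logPQ n / 10 ^ (n + 1) := by
      have := hc n
      gcongr
    have h2 : c / (9 * 10 ^ n) = c / 10 ^ (n + 1) + c / (9 * 10 ^ (n + 1)) := by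
      field_simp
      ring
    rw [logCount_succ]
    linarith

theorem tendsto_const_div_pow (c : ℝ) :
    Tendsto (fun n : ℕ => c / (9 * 10 ^ n)) atTop (𝓝 0) := by
  refine Tendsto.const_div_atTop ?_ c
  exact (tendsto_pow_atTop_atTop_of_one_lt (by norm_num)).const_mul_atTop (by norm_num)

theorem exists_tendsto_logCount : ∃ a, Tendsto logCount atTop (𝓝 a) := by
  refine ⟨_, tendsto_atTop_ciSup logCount_monotone
    ⟨logCount 1 + logPQ 1 / (9 * 10 ^ 1), ?_⟩⟩
  rintro _ ⟨n, rfl⟩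
  have h1 := logCount_upper one_pos (Nat.le_add_left 1 n)
  have h2 := logCount_monotone (Nat.le_succ n)
  have : 0 ≤ logPQ 1 / (9 * 10 ^ (n + 1)) := by
    have := logPQ_pos 1
    positivity
  linarith

theorem log_f_div_card (n : ℕ) : Real.log (f 4 n) / ((verts 4 n).card : ℝ) =
    (logCount n + 2 * (Real.log (α 4 n) / 10 ^ n)) / (4 + 5 / 10 ^ n) := by
  have h1 : ((verts 4 n).card : ℝ) = (4 * 10 ^ n + 5) / 3 := by
    have : (3 : ℝ) * (verts 4 n).card = 4 * 10 ^ n + 5 := by exact_mod_cast card_verts n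
    linarith
  rw [h1, logCount, α, Real.log_div (f_pos n).ne' (g_pos n).ne']
  field_simp
  ring

theorem tendsto_log_α_div : Tendsto (fun n : ℕ => Real.log (α 4 n) / 10 ^ n) atTop (𝓝 0) := by
  have h0 : Tendsto (fun n : ℕ => ((n + 1) * Real.log 10) / (10 : ℝ) ^ n) atTop (𝓝 0) := by
    have h1 := tendsto_pow_const_div_const_pow_of_one_lt 1 (r := (10 : ℝ)) (by norm_num)
    have h2 := tendsto_pow_const_div_const_pow_of_one_lt 0 (r := (10 : ℝ)) (by norm_num)
    have := (h1.add h2).mul_const (Real.log 10)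
    simp only [add_zero, zero_mul] at this
    refine this.congr fun n => ?_
    simp only [pow_one, pow_zero]
    ring
  refine squeeze_zero_norm (fun n => ?_) h0
  rw [Real.norm_eq_abs, abs_div, abs_of_pos (by positivity : (0 : ℝ) < 10 ^ n)]
  have := abs_log_α_le n
  gcongr

end SierpinskiGasket

open SierpinskiGasket in
theorem mainTheorem7 :
    (∀ n : ℕ, f 4 (n + 1) =
        f 4 n ^ 10 + 27 * f 4 n ^ 9 * g 4 n + 7 * f 4 n ^ 9 * h 4 n + 309 * f 4 n ^ 8 * g 4 n ^ 2
          + 144 * f 4 n ^ 8 * g 4 n * h 4 n + 1928 * f 4 n ^ 7 * g 4 n ^ 3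
          + 15 * f 4 n ^ 8 * h 4 n ^ 2 + 1140 * f 4 n ^ 7 * g 4 n ^ 2 * h 4 n
          + 6936 * f 4 n ^ 6 * g 4 n ^ 4 + 174 * f 4 n ^ 7 * g 4 n * h 4 n ^ 2
          + 4140 * f 4 n ^ 6 * g 4 n ^ 3 * h 4 n + 13626 * f 4 n ^ 5 * g 4 n ^ 5
          + 2 * f 4 n ^ 7 * h 4 n ^ 3 + 516 * f 4 n ^ 6 * g 4 n ^ 2 * h 4 n ^ 2
          + 5856 * f 4 n ^ 5 * g 4 n ^ 4 * h 4 n + 11354 * f 4 n ^ 4 * g 4 n ^ 6) ∧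
    (∀ n : ℕ, g 4 (n + 1) =
        f 4 n ^ 9 * g 4 n + f 4 n ^ 9 * h 4 n + 28 * f 4 n ^ 8 * g 4 n ^ 2
          + 34 * f 4 n ^ 8 * g 4 n * h 4 n + 332 * f 4 n ^ 7 * g 4 n ^ 3
          + 6 * f 4 n ^ 8 * h 4 n ^ 2 + 462 * f 4 n ^ 7 * g 4 n ^ 2 * h 4 n
          + 2148 * f 4 n ^ 6 * g 4 n ^ 4 + 142 * f 4 n ^ 7 * g 4 n * h 4 n ^ 2
          + 3130 * f 4 n ^ 6 * g 4 n ^ 3 * h 4 n + 8015 * f 4 n ^ 5 * g 4 n ^ 5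
          + 12 * f 4 n ^ 7 * h 4 n ^ 3 + 1095 * f 4 n ^ 6 * g 4 n ^ 2 * h 4 n ^ 2
          + 10609 * f 4 n ^ 5 * g 4 n ^ 4 * h 4 n + 16250 * f 4 n ^ 4 * g 4 n ^ 6
          + 82 * f 4 n ^ 6 * g 4 n * h 4 n ^ 3 + 2786 * f 4 n ^ 5 * g 4 n ^ 3 * h 4 n ^ 2
          + 14480 * f 4 n ^ 4 * g 4 n ^ 5 * h 4 n + 13732 * f 4 n ^ 3 * g 4 n ^ 7) ∧
    (∀ n : ℕ, h 4 (n + 1) =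
        3 * f 4 n ^ 8 * g 4 n ^ 2 + 6 * f 4 n ^ 8 * g 4 n * h 4 n + 87 * f 4 n ^ 7 * g 4 n ^ 3
          + 3 * f 4 n ^ 8 * h 4 n ^ 2 + 189 * f 4 n ^ 7 * g 4 n ^ 2 * h 4 n
          + 1068 * f 4 n ^ 6 * g 4 n ^ 4 + 117 * f 4 n ^ 7 * g 4 n * h 4 n ^ 2
          + 2558 * f 4 n ^ 6 * g 4 n ^ 3 * h 4 n + 7113 * f 4 n ^ 5 * g 4 n ^ 5
          + 15 * f 4 n ^ 7 * h 4 n ^ 3 + 1869 * f 4 n ^ 6 * g 4 n ^ 2 * h 4 n ^ 2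
          + 17763 * f 4 n ^ 5 * g 4 n ^ 4 * h 4 n + 26934 * f 4 n ^ 4 * g 4 n ^ 6
          + 444 * f 4 n ^ 6 * g 4 n * h 4 n ^ 3 + 12756 * f 4 n ^ 5 * g 4 n ^ 3 * h 4 n ^ 2
          + 61422 * f 4 n ^ 4 * g 4 n ^ 5 * h 4 n + 53826 * f 4 n ^ 3 * g 4 n ^ 7
          + 20 * f 4 n ^ 6 * h 4 n ^ 4 + 2388 * f 4 n ^ 5 * g 4 n ^ 2 * h 4 n ^ 3
          + 30948 * f 4 n ^ 4 * g 4 n ^ 4 * h 4 n ^ 2 + 83234 * f 4 n ^ 3 * g 4 n ^ 6 * h 4 n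
          + 42210 * f 4 n ^ 2 * g 4 n ^ 8) ∧
    ∃ z : ℝ,
      Tendsto (fun n : ℕ => Real.log (f 4 n) / ((verts 4 n).card : ℝ)) atTop (𝓝 z) ∧
      ∀ m : ℕ, 0 < m →
        1 / (4 * 10 ^ m) * (Real.log (f 4 m) + 2 * Real.log (g 4 m))
            + 1 / (36 * 10 ^ m) * (Real.log 33620 + 2 * Real.log 84460) ≤ z ∧
        z ≤ 1 / (4 * 10 ^ m) * (Real.log (f 4 m) + 2 * Real.log (g 4 m))
            + 1 / (36 * 10 ^ m) * (Real.log (P24 m) + 2 * Real.log (Q24 m)) := by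
  refine ⟨fun n => by rw [f_succ, treeSum_all], fun n => by rw [g_succ, treeSum_solo],
    fun n => by rw [h_succ, treeSum_apart], ?_⟩
  obtain ⟨a, ha⟩ := exists_tendsto_logCount
  refine ⟨a / 4, ?_, fun m hm => ?_⟩
  · simp only [log_f_div_card]
    have h5 : Tendsto (fun n : ℕ => (5 : ℝ) / 10 ^ n) atTop (𝓝 0) :=
      (tendsto_pow_atTop_atTop_of_one_lt (by norm_num)).const_div_atTop 5
    have := (ha.add (tendsto_log_α_div.const_mul 2)).div (h5.const_add 4) (by norm_num)
    rw [mul_zero, add_zero, add_zero] at this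
    exact this
  · have h1 : a ≤ logCount m + logPQ m / (9 * 10 ^ m) := by
      have := ha.add (tendsto_const_div_pow (logPQ m))
      rw [add_zero] at this
      exact le_of_tendsto this (eventually_atTop.2 ⟨m, fun n hn => logCount_upper hm hn⟩)
    have h2 : logCount m + (Real.log 33620 + 2 * Real.log 84460) / (9 * 10 ^ m) ≤ a := by
      have := ha.add (tendsto_const_div_pow (Real.log 33620 + 2 * Real.log 84460))
      rw [add_zero] at this
      exact ge_of_tendsto this
        (eventually_atTop.2 ⟨m, fun n hn => logCount_lower hn le_logPQ⟩)
    have h3 : 1 / (4 * 10 ^ m) * (Real.log (f 4 m) + 2 * Real.log (g 4 m)) = logCount m / 4 := by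
      rw [logCount]; field_simp
    have h4 : ∀ x : ℝ, 1 / (36 * 10 ^ m) * x = x / (9 * 10 ^ m) / 4 := fun x => by
      field_simp; ring
    rw [h3, h4, h4]
    constructor
    · linarith
    · rw [logPQ] at h1
      linarith
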